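/- **Setting.** Let $\mathbb F$ be the category of finite cardinals $n=\{0,\dots,n-1\}$ and all functions, and work in the presheaf category $\mathbf{Set}^{\mathbb F}$. Put $V(n)=n$, $\delta X(n)=X(n+1)$, $\langle\!\langle X,Y\rangle\!\rangle(n)=\mathbf{Set}^{\mathbb F}(X^n,Y)$, let $Y^X$ be the exponential (with evaluation $f(e)$ for $f\in Y^X(n)$, $e\in X(n)$) and $\mathcal P_\star X=\mathcal P\circ X$. Let $$\Sigma X=V+\delta X+X\times X,\qquad B_0(X,Y)=\langle\!\langle X,Y\rangle\!\rangle\times(Y+Y^X+1),\qquad B(X,Y)=\langle\!\langle X,Y\rangle\!\rangle\times\mathcal P_\star(Y+Y^X).$$ $\Sigma^\star$ denotes the free monad on $\Sigma$, with unit $\eta$. The initial $\Sigma$-algebra $(\Lambda,\iota)$ is the presheaf of $\lambda$-terms modulo $\alpha$-equivalence, $\Lambda(n)$ being the terms with free variables in $n$. On $\Lambda(n)$ let $\to$ be call-by-name reduction, generated by: $s\to s'$ implies $s\,t\to s'\,t$; and $(\lambda x.s)\,t\to s[t/x]$. Let $\Rightarrow$ be its reflexive transitive closure. **The laws.** A $V$-pointed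 higher-order GSOS law of $\Sigma$ over a bifunctor $H$ is a family of morphisms $\rho_{X,Y}\colon\Sigma(X\times H(X,Y))\to H(X,\Sigma^\star(X+Y))$, dinatural in $(X,\mathsf{var})\in V/\mathbf{Set}^{\mathbb F}$ and natural in $Y$. Its operational model is the unique $\gamma\colon\Lambda\to H(\Lambda,\Lambda)$ with $$\gamma\circ\iota=H(\Lambda,\hat\iota)\circ H(\Lambda,\Sigma^\star\nabla)\circ\rho_{\Lambda,\Lambda}\circ\Sigma\langle\mathrm{id},\gamma\rangle ,$$ where $\hat\iota\colon\Sigma^\star\Lambda\to\Lambda$ is the free extension of $\mathrm{id}_\Lambda$ and $\nabla$ the codiagonal. For $f\colon X^{n+1}\to Y$ let $\rho_1(f)\colon X^n\to\delta Y$, $\rho_1(f)(\vec u)=f_{m+1}(\mathrm{up}(\vec u),\mathsf{var}_{m+1}(m))$ for $\vec u\in X(m)^n$, where $\mathrm{up}=X(m\hookrightarrow m+1)$, and let $\rho_2(f)\in Y^X(n)$ be given by $\rho_2(f)(e)=f_n(\mathsf{var}_n(0),\dots,\mathsf{var}_n(n-1),e)$. The law $\rho^0$ of $\Sigma$ over $B_0$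 is given at $n$, with the inclusions of $X$ and $Y$ into $\Sigma^\star(X+Y)$ left implicit, by - $v\in V(n)\ \mapsto\ (\vec u\mapsto u_v,\ *)$; - $\lambda.(t,f,\_)\ \mapsto\ (\vec u\mapsto\lambda.\rho_1(f)(\vec u),\ \rho_2(f))$; - $(t_1,g,t_1')\,(t_2,h,\_)\ \mapsto\ (\vec u\mapsto g(\vec u)\,h(\vec u),\ t_1'\,t_2)$ for $t_1'\in Y(n)$; - $(t_1,g,k)\,(t_2,h,\_)\ \mapsto\ (\vec u\mapsto g(\vec u)\,h(\vec u),\ k(t_2))$ for $k\in Y^X(n)$; - $(t_1,g,*)\,(t_2,h,\_)\ \mapsto\ (\vec u\mapsto g(\vec u)\,h(\vec u),\ *)$. The law $\rho$ of $\Sigma$ over $B$ has the same first component (which ignores the last entries). Its second component first replaces every set $A\in\mathcal P(Y+Y^X)$ in the argument by $\varepsilon(A)\in\mathcal P(Y+Y^X+1)$, where $\varepsilon(\emptyset)=\{*\}$ and $\varepsilon(A)=A$ for $A\neq\emptyset$; then it forms the set of all arguments of $\rho^0$ that arise by choosing an element of each of these sets, takes the image of that set under the second component of $\rho^0$, and removes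 $*$. Let $\gamma^0=\langle\gamma^0_1,\gamma^0_2\rangle$ and $\gamma=\langle\gamma_1,\gamma_2\rangle$ be the operational models of $\rho^0$ and of $\rho$. The weak operational model is $\widetilde\gamma=\langle\gamma_1,\widetilde\gamma_2\rangle\colon\Lambda\to B(\Lambda,\Lambda)$ with $$\widetilde\gamma_2(t)=\{\bar t\in\Lambda(n): t\Rightarrow\bar t\}\cup\{f\in\Lambda^\Lambda(n):\exists\,\bar t.\ t\Rightarrow\bar t\ \wedge\ \gamma^0_2(\bar t)=f\}\qquad(t\in\Lambda(n)).$$ **Relations and simulations.** A relation on $X$ is a subpresheaf $R\subseteq X\times X$, with projections $\mathsf{outl}_R,\mathsf{outr}_R\colon R\to X$. The canonical lifting $\overline H(R,S)$ of a bifunctor $H$, for relations $R$ on $X$ and $S$ on $Y$, is the relation on $H(X,Y)$ consisting of all $(p,q)$ for which there is $z\in H(R,S)$ with $H(R,\mathsf{outl}_S)(z)=H(\mathsf{outl}_R,Y)(p)$ and $H(R,\mathsf{outr}_S)(z)=H(\mathsf{outr}_R,Y)(q)$. The lifting $\overline B$ is the product of the canonical lifting of $\langle\!\langle X,Y\rangle\!\rangle$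 with the one-sided Egli–Milner lifting $\{(A,A'):\forall a\in A\,\exists a'\in A'.\ (a,a')\in T\}$ applied to the canonical lifting $T$ of $Y+Y^X$. For coalgebras $c,\tilde c\colon C\to B(C,C)$ and a relation $R$ on $C$, let $E=\overline B(\Delta_C,R)$, where $\Delta_C$ is the diagonal. Then $R$ is a simulation on $(C,\tilde c)$ if some morphism $r\colon R\to E$ satisfies $\mathsf{outl}_E\circ r=\tilde c\circ\mathsf{outl}_R$ and $\mathsf{outr}_E\circ r=\tilde c\circ\mathsf{outr}_R$. The coalgebra $\tilde c$ is a weakening of $c$ if, for every $R$, this is equivalent to the existence of a morphism $r\colon R\to E$ with $\mathsf{outl}_E\circ r=c\circ\mathsf{outl}_R$ and $\mathsf{outr}_E\circ r=\tilde c\circ\mathsf{outr}_R$. In that case $R$ is a weak simulation on $(C,c)$ with respect to $\tilde c$ if the two equivalent conditions hold, and weak similarity $\lesssim$ is the greatest weak simulation. **Applicative similarity.** $\lesssim^{\mathrm{ap}}_0$ is the greatest relation on the set $\Lambda(0)$ of closed terms such that $t_1\lesssim^{\mathrm{ap}}_0t_2$ and $t_1\Rightarrow\lambda x.t_1'$ imply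 that there is $t_2'$ with $t_2\Rightarrow\lambda x.t_2'$ and $t_1'[e/x]\lesssim^{\mathrm{ap}}_0t_2'[e/x]$ for all $e\in\Lambda(0)$. Its open extension $\lesssim^{\mathrm{ap}}$ is the relation on $\Lambda$ with component $\lesssim^{\mathrm{ap}}_0$ at $0$ and, for $n>0$, $t_1\lesssim^{\mathrm{ap}}_nt_2$ iff $t_1[\vec u]\lesssim^{\mathrm{ap}}_0t_2[\vec u]$ for all $\vec u\in\Lambda(0)^n$. **Proposition.** The coalgebra $\widetilde\gamma$ is a weakening of the operational model $\gamma$ of $\rho$. Weak similarity on $(\Lambda,\gamma)$ with respect to $\widetilde\gamma$ exists and coincides with the open extension of applicative similarity: $$\lesssim\;=\;\lesssim^{\mathrm{ap}}.$$ -/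

import Mathlib

open CategoryTheory Opposite
open CategoryTheory.FunctorToTypes (prod coprod)
open scoped CategoryTheory.Prod

namespace LambdaGSOS

/-- Finite cardinals `n = {0, …, n-1}`. -/
structure FinCard : Type where
  card : ℕ

/-- The category `𝔽` of finite cardinals and all functions between them. -/
instance : SmallCategory FinCard where
  Hom n m := Fin n.card → Fin m.card
  id _ := id
  comp f g := g ∘ f

/-- The cardinal `n + 1`. -/
abbrev FinCard.succ (n : FinCard) : FinCard := ⟨n.card + 1⟩

/-- The empty cardinal. -/
abbrev FinCard.zero : FinCard := ⟨0⟩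

/-- The presheaf category `Set^𝔽`. -/
abbrev Psh : Type 1 := FinCard ⥤ Type

/-- The tuple `(u₀, …, uₙ₋₁, a)`. -/
def snoc {n : ℕ} {α : Type} (u : Fin n → α) (a : α) : Fin (n + 1) → α :=
  Fin.snoc (α := fun _ => α) u a

@[simp] theorem snoc_castSucc {n : ℕ} {α : Type} (u : Fin n → α) (a : α) (i : Fin n) :
    snoc u a i.castSucc = u i := Fin.snoc_castSucc (α := fun _ => α) a u i

@[simp] theorem snoc_last {n : ℕ} {α : Type} (u : Fin n → α) (a : α) :
    snoc u a (Fin.last n) = a := Fin.snoc_last (α := fun _ => α) a u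

theorem snoc_ext {n : ℕ} {α : Type} {u v : Fin (n + 1) → α}
    (h : ∀ i : Fin n, u i.castSucc = v i.castSucc) (h' : u (Fin.last n) = v (Fin.last n)) :
    u = v := by
  funext i
  exact Fin.lastCases (motive := fun i => u i = v i) h' h i

theorem comp_snoc {n : ℕ} {α β : Type} (f : α → β) (u : Fin n → α) (a : α) :
    (fun i => f (snoc u a i)) = snoc (fun i => f (u i)) (f a) :=
  snoc_ext (by simp) (by simp)

/-- `r + 1 : n + 1 → m + 1`, fixing the new element. -/
def lift {n m : FinCard} (r : n ⟶ m) : n.succ ⟶ m.succ :=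
  snoc (fun i => (r i).castSucc) (Fin.last m.card)

/-- The inclusion `old : n → n + 1`. -/
def old (n : FinCard) : n ⟶ n.succ := Fin.castSucc

theorem snoc_lift {n m : FinCard} {α : Type} (r : n ⟶ m) (u : Fin m.card → α) (a : α) :
    (fun i => snoc u a (lift r i)) = snoc (fun i => u (r i)) a :=
  snoc_ext (fun i => by simp [lift]) (by simp [lift])

theorem lift_id (n : FinCard) : lift (𝟙 n) = 𝟙 n.succ := 
  snoc_ext (u := lift (𝟙 n)) (v := 𝟙 n.succ) 
    (fun i => by simp [lift]; rfl) (by simp [lift]; rfl)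

theorem lift_comp {n m k : FinCard} (r : n ⟶ m) (s : m ⟶ k) : lift (r ≫ s) = lift r ≫ lift s :=
  snoc_ext (u := lift (r ≫ s)) (v := lift r ≫ lift s) 
    (fun i => by change _ = lift s (lift r i.castSucc); simp [lift]; rfl) 
    (by change _ = lift s (lift r (Fin.last _)); simp [lift])

theorem old_lift {n m : FinCard} (r : n ⟶ m) : old n ≫ lift r = r ≫ old m := by
  funext i
  change lift r (i.castSucc) = (r i).castSucc
  simp [lift]

/-- A presheaf from its action on elements. -/
def mkPsh (obj : FinCard → Type) (map : ∀ n m : FinCard, (n ⟶ m) → obj n → obj m)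
    (hid : ∀ n x, map n n (𝟙 n) x = x)
    (hcomp : ∀ (n m k : FinCard) (r : n ⟶ m) (s : m ⟶ k) (x : obj n),
      map n k (r ≫ s) x = map m k s (map n m r x)) : Psh where
  obj := obj
  map r := ↾(map _ _ r)
  map_id n := by ext x; exact hid n x
  map_comp r s := by ext x; exact hcomp _ _ _ r s x

/-- A natural transformation of presheaves from its components. -/
def mkHom {X Y : Psh} (f : ∀ n, X.obj n → Y.obj n)
    (h : ∀ (n m : FinCard) (r : n ⟶ m) (x : X.obj n), f m (X.map r x) = Y.map r (f n x)) :
    X ⟶ Y where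
  app n := ↾(f n)
  naturality n m r := by ext x; exact h n m r x

@[simp] theorem mkHom_app {X Y : Psh} (f : ∀ n, X.obj n → Y.obj n) (h) (n : FinCard)
    (x : X.obj n) : (mkHom f h : X ⟶ Y).app n x = f n x := rfl

theorem hom_ext {X Y : Psh} {f g : X ⟶ Y} (h : ∀ n (x : X.obj n), f.app n x = g.app n x) :
    f = g := by
  ext n x; exact h n x

theorem nat {X Y : Psh} (f : X ⟶ Y) {n m : FinCard} (r : n ⟶ m) (x : X.obj n) :
    f.app m (X.map r x) = Y.map r (f.app n x) := NatTrans.naturality_apply f r x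

theorem map_id' (X : Psh) {n : FinCard} (x : X.obj n) : X.map (𝟙 n) x = x :=
  X.map_id_apply n x

theorem map_comp' (X : Psh) {n m k : FinCard} (r : n ⟶ m) (s : m ⟶ k) (x : X.obj n) :
    X.map (r ≫ s) x = X.map s (X.map r x) := X.map_comp_apply r s x

theorem happ {X Y : Psh} {f g : X ⟶ Y} (h : f = g) {n : FinCard} (x : X.obj n) :
    f.app n x = g.app n x := by rw [h]

/-! ### Presheaves and (bi)functors -/

/-- The presheaf `V(n) = n` of variables. -/
def V : Psh where
  obj n := Fin n.card
  map r := ↾r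

/-- An element of `n`, as an element of `V(n)`. -/
abbrev vr {n : FinCard} (i : Fin n.card) : V.obj n := i

/-- The functor `δ`, `δX(n) = X(n+1)`. -/
def delta : Psh ⥤ Psh where
  obj X :=
    { obj := fun n => X.obj n.succ
      map := fun r => X.map (lift r)
      map_id := fun n => by rw [lift_id]; exact X.map_id _
      map_comp := fun r s => by rw [lift_comp]; exact X.map_comp _ _ }
  map f :=
    { app := fun n => f.app n.succ
      naturality := fun _ _ r => f.naturality (lift r) }

/-- The morphism `f × g`. -/
abbrev prodMap {X Y X' Y' : Psh} (f : X ⟶ X') (g : Y ⟶ Y') : prod X Y ⟶ prod X' Y' :=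
  FunctorToTypes.prod.lift (FunctorToTypes.prod.fst ≫ f) (FunctorToTypes.prod.snd ≫ g)

/-- The morphism `f + g`. -/
abbrev coprodMap {X Y X' Y' : Psh} (f : X ⟶ X') (g : Y ⟶ Y') : coprod X Y ⟶ coprod X' Y' :=
  FunctorToTypes.coprod.desc (f ≫ FunctorToTypes.coprod.inl) (g ≫ FunctorToTypes.coprod.inr)

/-- The syntax functor `ΣX = V + (δX + X × X)`. -/
def Sig : Psh ⥤ Psh where
  obj X := coprod V (coprod (delta.obj X) (prod X X))
  map f := coprodMap (𝟙 V) (coprodMap (delta.map f) (prodMap f f))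
  map_id X := hom_ext (by rintro n (x | x | x) <;> rfl)
  map_comp f g := hom_ext (by rintro n (x | x | x) <;> rfl)

/-- The terminal presheaf `1`. -/
def one : Psh := (Functor.const FinCard).obj Unit

/-- The pointwise powerset functor `𝒫⋆ X = 𝒫 ∘ X`. -/
def Pow : Psh ⥤ Psh where
  obj X := mkPsh (fun n => Set (X.obj n)) (fun _ _ r A => X.map r '' A)
    (fun n A => by simp)
    (fun n m k r s A => by simp [Set.image_image])
  map {X Y} f := mkHom (fun n (A : Set (X.obj n)) => f.app n '' A)
    (fun n m r (A : Set (X.obj n)) => by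
      have : (f.app m '' (X.map r '' A)) = Y.map r '' (f.app n '' A) := by
        simp only [Set.image_image, nat]
      exact this)
  map_id X := hom_ext (fun n (A : Set (X.obj n)) => Set.image_id A)
  map_comp f g := hom_ext (fun n A => (Set.image_image (g.app n) (f.app n) A).symm)

/-- The power `Xⁿ`. -/
def power (X : Psh) (n : FinCard) : Psh :=
  mkPsh (fun m => Fin n.card → X.obj m) (fun _ _ s u i => X.map s (u i))
    (fun m u => by simp) (fun m k l r s u => by simp)

/-- A tuple, as an element of a power. -/
abbrev tup {X : Psh} {n m : FinCard} (u : Fin n.card → X.obj m) : (power X n).obj m := u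

/-- `hⁿ : Xⁿ → X'ⁿ`. -/
def powerMap {X X' : Psh} (h : X ⟶ X') (n : FinCard) : power X n ⟶ power X' n :=
  mkHom (fun m u i => h.app m (u i)) (fun _ _ r u => by funext i; exact nat h r (u i))

/-- `X^r : Xᵐ → Xⁿ`, `(uⱼ)ⱼ ↦ (u_{r i})ᵢ`, for `r : n → m`. -/
def powerReindex (X : Psh) {n m : FinCard} (r : n ⟶ m) : power X m ⟶ power X n :=
  mkHom (fun _ u i => u (r i)) (fun _ _ _ _ => rfl)

/-- The bifunctor `(X, Y) ↦ ⟪X, Y⟫`, `⟪X, Y⟫(n) = Set^𝔽(Xⁿ, Y)`. -/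
def Sub : Pshᵒᵖ × Psh ⥤ Psh where
  obj p := mkPsh (fun n => (power p.1.unop n ⟶ p.2))
    (fun _ _ r f => powerReindex p.1.unop r ≫ f) (fun _ _ => rfl) (fun _ _ _ _ _ _ => rfl)
  map q := mkHom (fun n f => powerMap q.1.unop n ≫ f ≫ q.2) (fun _ _ _ _ => rfl)
  map_id _ := rfl
  map_comp _ _ := rfl

/-- `f(r; x)` for `f ∈ Y^X(n)`, `r : n → m` and `x ∈ X(m)`. Here `Y^X` is Mathlib's exponential
presheaf; its elements at `n` are the families of maps `X(m) → Y(m)`, for `r : n → m`, that are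
natural in `m`. -/
def expApp {X Y : Psh} {n m : FinCard} (f : (X.functorHom Y).obj n) (r : n ⟶ m) (x : X.obj m) :
    Y.obj m :=
  (show Functor.HomObj X Y (coyoneda.obj (op n)) from f).app m r x

theorem expApp_nat {X Y : Psh} {n m k : FinCard} (f : (X.functorHom Y).obj n) (r : n ⟶ m)
    (s : m ⟶ k) (x : X.obj m) : expApp f (r ≫ s) (X.map s x) = Y.map s (expApp f r x) :=
  ConcreteCategory.congr_hom
    ((show Functor.HomObj X Y (coyoneda.obj (op n)) from f).naturality s r) x

/-- An element of `Y^X(n)` from its family of maps. -/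
def mkExp {X Y : Psh} {n : FinCard} (f : ∀ m : FinCard, (n ⟶ m) → X.obj m → Y.obj m)
    (h : ∀ (m k : FinCard) (r : n ⟶ m) (s : m ⟶ k) (x : X.obj m),
      f k (r ≫ s) (X.map s x) = Y.map s (f m r x)) : (X.functorHom Y).obj n :=
  show Functor.HomObj X Y (coyoneda.obj (op n)) from
    { app := fun m r => ↾(f m r)
      naturality := fun {m k} s r => by ext x; exact h m k r s x }

@[simp] theorem expApp_mkExp {X Y : Psh} {n : FinCard}
    (f : ∀ m : FinCard, (n ⟶ m) → X.obj m → Y.obj m) (h) {m : FinCard} (r : n ⟶ m)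
    (x : X.obj m) : expApp (mkExp f h) r x = f m r x := rfl

theorem exp_ext {X Y : Psh} {n : FinCard} {f g : (X.functorHom Y).obj n}
    (h : ∀ (m : FinCard) (r : n ⟶ m) (x : X.obj m), expApp f r x = expApp g r x) : f = g := by
  apply Functor.functorHom_ext
  intro m r
  ext x
  exact h m r x

theorem expApp_map {X Y : Psh} {n m k : FinCard} (f : (X.functorHom Y).obj n) (r : n ⟶ m)
    (s : m ⟶ k) (x : X.obj k) :
    expApp ((X.functorHom Y).map r f) s x = expApp f (r ≫ s) x := rfl

/-- The evaluation map `Y^X × X → Y`, `(f, e) ↦ f(e)`. -/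
def ev {X Y : Psh} {n : FinCard} (f : (X.functorHom Y).obj n) (e : X.obj n) : Y.obj n :=
  expApp f (𝟙 n) e

theorem ev_map {X Y : Psh} {n m : FinCard} (r : n ⟶ m) (f : (X.functorHom Y).obj n)
    (e : X.obj n) : ev ((X.functorHom Y).map r f) (X.map r e) = Y.map r (ev f e) := by
  unfold ev
  rw [expApp_map, ← expApp_nat]
  rfl

/-- The bifunctor `(X, Y) ↦ Y^X`. -/
def Expo : Pshᵒᵖ × Psh ⥤ Psh where
  obj p := p.1.unop.functorHom p.2
  map {p p'} q := mkHom
    (fun n f => mkExp (fun m r x => q.2.app m (expApp f r (q.1.unop.app m x)))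
      (fun m k r s x => by rw [nat, expApp_nat, nat]))
    (fun _ _ _ _ => rfl)
  map_id _ := rfl
  map_comp _ _ := rfl

/-- The second projection `Psh^op × Psh → Psh`. -/
abbrev sndF : Pshᵒᵖ × Psh ⥤ Psh := CategoryTheory.Prod.snd _ _

/-- The pointwise product of two bifunctors. -/
def biProd (F G : Pshᵒᵖ × Psh ⥤ Psh) : Pshᵒᵖ × Psh ⥤ Psh where
  obj p := prod (F.obj p) (G.obj p)
  map q := prodMap (F.map q) (G.map q)
  map_id p := by rw [F.map_id, G.map_id]; rfl
  map_comp q q' := by rw [F.map_comp, G.map_comp]; rfl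

/-- The pointwise coproduct of two bifunctors. -/
def biCoprod (F G : Pshᵒᵖ × Psh ⥤ Psh) : Pshᵒᵖ × Psh ⥤ Psh where
  obj p := coprod (F.obj p) (G.obj p)
  map q := coprodMap (F.map q) (G.map q)
  map_id p := by rw [F.map_id, G.map_id]; exact hom_ext (by rintro n (x | x) <;> rfl)
  map_comp q q' := by rw [F.map_comp, G.map_comp]; exact hom_ext (by rintro n (x | x) <;> rfl)

/-- The bifunctor `(X, Y) ↦ Y + Y^X`. -/
def G : Pshᵒᵖ × Psh ⥤ Psh := biCoprod sndF Expo

/-- The deterministic behaviour bifunctor `B₀(X, Y) = ⟪X, Y⟫ × ((Y + Y^X) + 1)`. -/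
def B0 : Pshᵒᵖ × Psh ⥤ Psh := biProd Sub (biCoprod G ((Functor.const _).obj one))

/-- The nondeterministic behaviour bifunctor `B(X, Y) = ⟪X, Y⟫ × 𝒫⋆(Y + Y^X)`. -/
def B : Pshᵒᵖ × Psh ⥤ Psh := biProd Sub (G ⋙ Pow)


/-! ### The free monad on `Σ` -/

/-- `Σ`-terms over the presheaf `X` of generators. -/
inductive FreeTm (X : Psh) : FinCard → Type
  | var {n : FinCard} (i : Fin n.card) : FreeTm X n
  | lam {n : FinCard} (t : FreeTm X n.succ) : FreeTm X n
  | app {n : FinCard} (s t : FreeTm X n) : FreeTm X n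
  | inc {n : FinCard} (x : X.obj n) : FreeTm X n

namespace FreeTm

/-- Renaming of variables. -/
def rename {X : Psh} : ∀ {n : FinCard}, FreeTm X n → ∀ {m : FinCard}, (n ⟶ m) → FreeTm X m
  | _, var i, _, r => var (r i)
  | _, lam t, _, r => lam (t.rename (lift r))
  | _, app s t, _, r => app (s.rename r) (t.rename r)
  | _, inc x, _, r => inc (X.map r x)

theorem rename_id {X : Psh} {n : FinCard} (t : FreeTm X n) : t.rename (𝟙 n) = t := by
  induction t with
  | var i => rfl
  | lam t ih => simp only [rename, lift_id, ih]
  | app s t ihs iht => simp only [rename, ihs, iht]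
  | inc x => simp only [rename, map_id']

theorem rename_comp {X : Psh} {n m k : FinCard} (r : n ⟶ m) (s : m ⟶ k) (t : FreeTm X n) :
    t.rename (r ≫ s) = (t.rename r).rename s := by
  induction t generalizing m k with
  | var i => rfl
  | lam t ih => simp only [rename, lift_comp, ih]
  | app s t ihs iht => simp only [rename, ihs, iht]
  | inc x => simp only [rename, map_comp']

end FreeTm

/-- The carrier `Σ⋆X` of the free `Σ`-algebra on `X`. -/
def FreeObj (X : Psh) : Psh :=
  mkPsh (FreeTm X) (fun _ _ r t => t.rename r) (fun _ t => t.rename_id)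
    (fun _ _ _ r s t => t.rename_comp r s)

/-- The operation of application on `Σ⋆X`. -/
def appOp (X : Psh) : prod (FreeObj X) (FreeObj X) ⟶ FreeObj X :=
  mkHom (fun _ p => FreeTm.app p.1 p.2) (fun _ _ _ _ => rfl)

/-- The operation of abstraction on `Σ⋆X`. -/
def lamOp (X : Psh) : delta.obj (FreeObj X) ⟶ FreeObj X :=
  mkHom (fun _ t => FreeTm.lam t) (fun _ _ _ _ => rfl)

/-- The inclusion of variables into `Σ⋆X`. -/
def varOp (X : Psh) : V ⟶ FreeObj X :=
  mkHom (fun _ i => FreeTm.var i) (fun _ _ _ _ => rfl)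

/-- The `Σ`-algebra structure of `Σ⋆X`. -/
def freeAlg (X : Psh) : Sig.obj (FreeObj X) ⟶ FreeObj X :=
  FunctorToTypes.coprod.desc (varOp X) (FunctorToTypes.coprod.desc (lamOp X) (appOp X))

/-- The universal morphism `η : X → Σ⋆X`. -/
def eta (X : Psh) : X ⟶ FreeObj X :=
  mkHom (fun _ x => FreeTm.inc x) (fun _ _ _ _ => rfl)

/-- A variable in `ΣX(n)`. -/
abbrev sVar {X : Psh} {n : FinCard} (i : Fin n.card) : (Sig.obj X).obj n := Sum.inl i

/-- An abstraction in `ΣX(n)`. -/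
abbrev sLam {X : Psh} {n : FinCard} (t : X.obj n.succ) : (Sig.obj X).obj n := Sum.inr (Sum.inl t)

/-- An application in `ΣX(n)`. -/
abbrev sApp {X : Psh} {n : FinCard} (s t : X.obj n) : (Sig.obj X).obj n :=
  Sum.inr (Sum.inr (s, t))

/-- The components of the extension of `h : X → A` to `Σ⋆X`, for a `Σ`-algebra `(A, a)`. -/
def freeExtFun {X A : Psh} (a : Sig.obj A ⟶ A) (h : X ⟶ A) :
    ∀ {n : FinCard}, FreeTm X n → A.obj n
  | n, .var i => a.app n (sVar i)
  | n, .lam t => a.app n (sLam (freeExtFun a h t))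
  | n, .app s t => a.app n (sApp (freeExtFun a h s) (freeExtFun a h t))
  | n, .inc x => h.app n x

theorem freeExtFun_rename {X A : Psh} (a : Sig.obj A ⟶ A) (h : X ⟶ A) {n m : FinCard}
    (r : n ⟶ m) (t : FreeTm X n) :
    freeExtFun a h (t.rename r) = A.map r (freeExtFun a h t) := by
  induction t generalizing m with
  | var i => exact nat a r (sVar i)
  | lam t ih =>
    rw [FreeTm.rename, freeExtFun, ih]
    exact nat a r (sLam (freeExtFun a h t))
  | app s t ihs iht =>
    rw [FreeTm.rename, freeExtFun, ihs, iht]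
    exact nat a r (sApp (freeExtFun a h s) (freeExtFun a h t))
  | inc x => exact nat h r x

/-- The extension `h⋆ : Σ⋆X → A` of `h : X → A`, for a `Σ`-algebra `(A, a)`. -/
def freeExt {X A : Psh} (a : Sig.obj A ⟶ A) (h : X ⟶ A) : FreeObj X ⟶ A :=
  mkHom (fun _ t => freeExtFun a h t) (fun _ _ r t => freeExtFun_rename a h r t)

theorem freeExt_unique {X A : Psh} (a : Sig.obj A ⟶ A) (h : X ⟶ A) (g : FreeObj X ⟶ A)
    (hg : freeAlg X ≫ g = Sig.map g ≫ a) (hg' : eta X ≫ g = h) : g = freeExt a h := by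
  have key : ∀ (n : FinCard) (x : (Sig.obj (FreeObj X)).obj n), g.app n ((freeAlg X).app n x) = a.app n ((Sig.map g).app n x) := fun n x =>
    ConcreteCategory.congr_hom (NatTrans.congr_app hg n) x
  have main : ∀ (n : FinCard) (t : FreeTm X n), g.app n t = freeExtFun a h t := by
   intro n t
   induction t with
   | var i => exact key _ (sVar i)
   | lam t ih =>
     rw [freeExtFun, ← ih]
     exact key _ (sLam t)
   | app s t ihs iht =>
     rw [freeExtFun, ← ihs, ← iht]
     exact key _ (sApp s t)
   | inc x => exact ConcreteCategory.congr_hom (NatTrans.congr_app hg' _) x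
  exact hom_ext main

/-- `Σ⋆X` is the free `Σ`-algebra on `X`. -/
theorem free_universal {X A : Psh} (a : Sig.obj A ⟶ A) (h : X ⟶ A) :
    ∃! g : FreeObj X ⟶ A, freeAlg X ≫ g = Sig.map g ≫ a ∧ eta X ≫ g = h :=
  ⟨freeExt a h, ⟨hom_ext (by rintro n (x | x | ⟨x, y⟩) <;> rfl), rfl⟩,
    fun g hg => freeExt_unique a h g hg.1 hg.2⟩

/-- The free monad `Σ⋆`, as a functor. -/
def Free : Psh ⥤ Psh where
  obj X := FreeObj X
  map {X Y} f := freeExt (freeAlg Y) (f ≫ eta Y)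
  map_id X := (freeExt_unique (freeAlg X) (𝟙 X ≫ eta X) (𝟙 (FreeObj X))
    (by rw [Sig.map_id]; rfl) rfl).symm
  map_comp {X Y Z} f g := (freeExt_unique (freeAlg Z) ((f ≫ g) ≫ eta Z)
    (freeExt (freeAlg Y) (f ≫ eta Y) ≫ freeExt (freeAlg Z) (g ≫ eta Z))
    (hom_ext (by rintro n (x | x | ⟨x, y⟩) <;> rfl)) rfl).symm

/-! ### The higher-order GSOS law -/

/-- A `V`-pointed higher-order GSOS law of `Σ` over a bifunctor `H`: a family of morphisms
`Σ(X × H(X, Y)) → H(X, Σ⋆(X + Y))`, natural in `Y` and dinatural in the `V`-pointed presheaf `X`. -/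
structure HOLaw (H : Pshᵒᵖ × Psh ⥤ Psh) where
  /-- The component at `(X, Y)`. -/
  app (X : Under V) (Y : Psh) :
    Sig.obj (prod X.right (H.obj (op X.right, Y))) ⟶
      H.obj (op X.right, Free.obj (coprod X.right Y))
  natural (X : Under V) {Y Y' : Psh} (k : Y ⟶ Y') :
    Sig.map (prodMap (𝟙 X.right) (H.map (𝟙 (op X.right) ×ₘ k))) ≫ app X Y' =
      app X Y ≫ H.map (𝟙 (op X.right) ×ₘ Free.map (coprodMap (𝟙 X.right) k))
  dinatural {X X' : Under V} (h : X ⟶ X') (Y : Psh) :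
    Sig.map (prodMap (𝟙 X.right) (H.map (h.right.op ×ₘ 𝟙 Y))) ≫ app X Y ≫
        H.map (𝟙 (op X.right) ×ₘ Free.map (coprodMap h.right (𝟙 Y))) =
      Sig.map (prodMap h.right (𝟙 (H.obj (op X'.right, Y)))) ≫ app X' Y ≫
        H.map (h.right.op ×ₘ 𝟙 (Free.obj (coprod X'.right Y)))

/-- The element `var_n(i)` of a `V`-pointed presheaf. -/
def pt (X : Under V) {n : FinCard} (i : Fin n.card) : X.right.obj n :=
  X.hom.app n (vr i)

theorem pt_map (X : Under V) {n m : FinCard} (r : n ⟶ m) (i : Fin n.card) :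
    X.right.map r (pt X i) = pt X (r i) := (nat X.hom r (vr i)).symm

theorem pt_hom {X X' : Under V} (h : X ⟶ X') {n : FinCard} (i : Fin n.card) :
    h.right.app n (pt X i) = pt X' i :=
  ConcreteCategory.congr_hom (NatTrans.congr_app (Under.w h) n) (vr i)

/-- `ρ₁ : δ⟪X, Y⟫ → ⟪X, δY⟫`, `ρ₁(f)(u) = f(up(u), var(new))`. -/
def rho1 (X : Under V) (Y : Psh) :
    delta.obj (Sub.obj (op X.right, Y)) ⟶ Sub.obj (op X.right, delta.obj Y) :=
  mkHom
    (fun n (f : power X.right n.succ ⟶ Y) =>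
      (mkHom
        (fun m (u : Fin n.card → X.right.obj m) =>
          f.app m.succ (tup (n := n.succ)
            (snoc (fun i => X.right.map (old m) (u i)) (pt X (Fin.last m.card)))))
        (fun m k s (u : Fin n.card → X.right.obj m) => by
          refine Eq.trans (congrArg (f.app k.succ) ?_) (nat f (lift s) _)
          refine snoc_ext (fun i => ?_) ?_
          · change snoc _ _ _ = X.right.map _ (snoc _ _ _)
            rw [snoc_castSucc, snoc_castSucc, ← map_comp', old_lift, map_comp']
            rfl
          · change snoc _ _ _ = X.right.map _ (snoc _ _ _)
            rw [snoc_last, snoc_last, pt_map]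
            simp [lift]) : power X.right n ⟶ delta.obj Y))
    (fun n m r (f : power X.right n.succ ⟶ Y) => by
      refine hom_ext (fun k (u : Fin m.card → X.right.obj k) => ?_)
      refine congrArg (f.app k.succ) ?_
      exact snoc_lift r (fun i => X.right.map (old k) (u i)) (pt X (Fin.last k.card)))

/-- `ρ₂ : δ⟪X, Y⟫ → Y^X`, `ρ₂(f)(e) = f(var(0), …, var(n-1), e)`. -/
def rho2 (X : Under V) (Y : Psh) :
    delta.obj (Sub.obj (op X.right, Y)) ⟶ Expo.obj (op X.right, Y) :=
  mkHom
    (fun n (f : power X.right n.succ ⟶ Y) =>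
      mkExp
        (fun m (r : n ⟶ m) e =>
          f.app m (tup (n := n.succ) (snoc (fun i => pt X (r i)) e)))
        (fun m k r s e => by
          refine Eq.trans (congrArg (f.app k) ?_) (nat f s _)
          refine snoc_ext (fun i => ?_) ?_
          · change snoc _ _ _ = X.right.map _ (snoc _ _ _)
            rw [snoc_castSucc, snoc_castSucc, pt_map]
            rfl
          · change snoc _ _ _ = X.right.map _ (snoc _ _ _)
            rw [snoc_last, snoc_last]))
    (fun n m r (f : power X.right n.succ ⟶ Y) => by
      refine exp_ext (fun k s e => ?_)
      refine congrArg (f.app k) ?_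
      exact snoc_lift r (fun i => pt X (s i)) e)


/-- The projections `π : V → ⟪X, Σ⋆(X + Y)⟫`. -/
def proj (X Y : Psh) : V ⟶ Sub.obj (op X, Free.obj (coprod X Y)) :=
  mkHom
    (fun n (v : Fin n.card) =>
      (mkHom (fun _ u => FreeTm.inc (Sum.inl (u v))) (fun _ _ _ _ => rfl) :
        power X n ⟶ FreeObj (coprod X Y)))
    (fun _ _ _ _ => rfl)

/-- `Y → Σ⋆(X + Y)`. -/
abbrev incr (X Y : Psh) : Y ⟶ Free.obj (coprod X Y) :=
  FunctorToTypes.coprod.inr ≫ eta (coprod X Y)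

/-- `X → Σ⋆(X + Y)`. -/
abbrev incl (X Y : Psh) : X ⟶ Free.obj (coprod X Y) :=
  FunctorToTypes.coprod.inl ≫ eta (coprod X Y)

/-- `(g, h) ↦ λ u. g(u) h(u)`. -/
def subApp (X Y : Psh) :
    prod (Sub.obj (op X, Y)) (Sub.obj (op X, Y)) ⟶ Sub.obj (op X, Free.obj (coprod X Y)) :=
  mkHom
    (fun n (p : (power X n ⟶ Y) × (power X n ⟶ Y)) =>
      FunctorToTypes.prod.lift (p.1 ≫ incr X Y) (p.2 ≫ incr X Y) ≫ appOp (coprod X Y))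
    (fun _ _ _ _ => rfl)

/-- The part of the law that describes the behaviour under substitution. -/
def tau (X : Under V) (Y : Psh) :
    Sig.obj (Sub.obj (op X.right, Y)) ⟶ Sub.obj (op X.right, Free.obj (coprod X.right Y)) :=
  FunctorToTypes.coprod.desc (proj X.right Y)
    (FunctorToTypes.coprod.desc
      (rho1 X Y ≫
        Sub.map (𝟙 (op X.right) ×ₘ (delta.map (incr X.right Y) ≫ lamOp (coprod X.right Y))))
      (subApp X.right Y))

theorem tau_natural (X : Under V) {Y Y' : Psh} (k : Y ⟶ Y') :
    Sig.map (Sub.map (𝟙 (op X.right) ×ₘ k)) ≫ tau X Y' =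
      tau X Y ≫ Sub.map (𝟙 (op X.right) ×ₘ Free.map (coprodMap (𝟙 X.right) k)) :=
  hom_ext (by rintro n (x | x | ⟨x, y⟩) <;> rfl)

theorem tau_dinatural {X X' : Under V} (h : X ⟶ X') (Y : Psh) :
    Sig.map (Sub.map (h.right.op ×ₘ 𝟙 Y)) ≫ tau X Y ≫
        Sub.map (𝟙 (op X.right) ×ₘ Free.map (coprodMap h.right (𝟙 Y))) =
      tau X' Y ≫ Sub.map (h.right.op ×ₘ 𝟙 (Free.obj (coprod X'.right Y))) := by
  refine hom_ext ?_
  rintro n (x | (x : power X'.right n.succ ⟶ Y) | ⟨x, y⟩)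
  · rfl
  · refine hom_ext (fun m (u : Fin n.card → X.right.obj m) => ?_)
    refine congrArg (fun w => FreeTm.lam ((incr X'.right Y).app m.succ (x.app m.succ w))) ?_
    refine (comp_snoc (h.right.app m.succ) (fun i => X.right.map (old m) (u i))
      (pt X (Fin.last m.card))).trans ?_
    have e : ∀ i, h.right.app m.succ (X.right.map (old m) (u i)) =
        X'.right.map (old m) (h.right.app m (u i)) := fun i => nat h.right (old m) (u i)
    rw [funext e, pt_hom]
    rfl
  · rfl

/-- The reduction behaviour (second component) of the deterministic law. -/
def sigma0Fun (X : Under V) (Y : Psh) (n : FinCard) :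
    (Sig.obj (prod X.right (B0.obj (op X.right, Y)))).obj n →
      (coprod (G.obj (op X.right, Free.obj (coprod X.right Y))) one).obj n
  | Sum.inl _ => Sum.inr ()
  | Sum.inr (Sum.inl (_, f, _)) =>
      Sum.inl (Sum.inr ((Expo.map (𝟙 (op X.right) ×ₘ incr X.right Y)).app n
        ((rho2 X Y).app n f)))
  | Sum.inr (Sum.inr ((_, _, Sum.inl (Sum.inl t₁')), (t₂, _, _))) =>
      Sum.inl (Sum.inl (FreeTm.app ((incr X.right Y).app n t₁') ((incl X.right Y).app n t₂)))
  | Sum.inr (Sum.inr ((_, _, Sum.inl (Sum.inr k)), (t₂, _, _))) =>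
      Sum.inl (Sum.inl ((incr X.right Y).app n (ev k t₂)))
  | Sum.inr (Sum.inr ((_, _, Sum.inr _), _)) => Sum.inr ()

/-- `sigma0Fun` as a morphism of presheaves. -/
def sigma0 (X : Under V) (Y : Psh) :
    Sig.obj (prod X.right (B0.obj (op X.right, Y))) ⟶
      coprod (G.obj (op X.right, Free.obj (coprod X.right Y))) one :=
  mkHom (sigma0Fun X Y) (by
    rintro n m r (x | ⟨t, f, b⟩ | ⟨⟨t₁, g, (t₁' | k) | b⟩, ⟨t₂, h, b'⟩⟩)
    · rfl
    · refine congrArg (fun z => Sum.inl (Sum.inr z)) ?_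
      exact (congrArg _ (nat (rho2 X Y) r f)).trans
        (nat (Expo.map (𝟙 (op X.right) ×ₘ incr X.right Y)) r _)
    · rfl
    · exact congrArg (fun z => Sum.inl (Sum.inl ((incr X.right Y).app m z))) (ev_map r k t₂)
    · rfl)

theorem sigma0_natural (X : Under V) {Y Y' : Psh} (k : Y ⟶ Y') :
    Sig.map (prodMap (𝟙 X.right) (B0.map (𝟙 (op X.right) ×ₘ k))) ≫ sigma0 X Y' =
      sigma0 X Y ≫ coprodMap
        (G.map (𝟙 (op X.right) ×ₘ Free.map (coprodMap (𝟙 X.right) k))) (𝟙 one) :=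
  hom_ext (by
    rintro n (x | ⟨t, f, b⟩ | ⟨⟨t₁, g, (t₁' | k) | b⟩, ⟨t₂, h, b'⟩⟩) <;> rfl)

theorem sigma0_dinatural {X X' : Under V} (h : X ⟶ X') (Y : Psh) :
    Sig.map (prodMap (𝟙 X.right) (B0.map (h.right.op ×ₘ 𝟙 Y))) ≫ sigma0 X Y ≫
        coprodMap (G.map (𝟙 (op X.right) ×ₘ Free.map (coprodMap h.right (𝟙 Y)))) (𝟙 one) =
      Sig.map (prodMap h.right (𝟙 (B0.obj (op X'.right, Y)))) ≫ sigma0 X' Y ≫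
        coprodMap (G.map (h.right.op ×ₘ 𝟙 (Free.obj (coprod X'.right Y)))) (𝟙 one) := by
  refine hom_ext ?_
  rintro n (x | ⟨t, (f : power X'.right n.succ ⟶ Y), b⟩ |
    ⟨⟨t₁, g, (t₁' | k) | b⟩, ⟨t₂, h, b'⟩⟩)
  · rfl
  · refine congrArg (fun z => Sum.inl (Sum.inr z)) ?_
    refine exp_ext (fun m r e => ?_)
    refine congrArg (fun w => (incr X'.right Y).app m (f.app m w)) ?_
    refine (comp_snoc (h.right.app m) (fun i => pt X (r i)) e).trans ?_
    have e' : ∀ i, h.right.app m (pt X (r i)) = pt X' (r i) := fun i => pt_hom h (r i)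
    rw [funext e']
    rfl
  · rfl
  · rfl
  · rfl

/-- The middle projection `X × S × T → S`. -/
def mid (X S T : Psh) : prod X (prod S T) ⟶ S :=
  mkHom (fun _ p => p.2.1) (fun _ _ _ _ => rfl)

/-- The higher-order GSOS law `ρ⁰` of the call-by-name λ-calculus over `B₀`. -/
def rho0 : HOLaw B0 where
  app X Y := FunctorToTypes.prod.lift (Sig.map (mid _ _ _) ≫ tau X Y) (sigma0 X Y)
  natural X {Y Y'} k := hom_ext (by
    intro n x
    refine Prod.ext ?_ (happ (sigma0_natural X k) x)
    refine Eq.trans ?_ (happ (tau_natural X k) ((Sig.map (mid _ _ _)).app n x))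
    rcases x with x | x | ⟨x, y⟩ <;> rfl)
  dinatural {X X'} h Y := hom_ext (by
    intro n x
    refine Prod.ext ?_ (happ (sigma0_dinatural h Y) x)
    refine Eq.trans ?_ ((happ (tau_dinatural h Y) ((Sig.map (mid _ _ _)).app n x)).trans ?_)
    · rcases x with x | x | ⟨x, y⟩ <;> rfl
    · rcases x with x | x | ⟨x, y⟩ <;> rfl)

/-- The map `𝒫A → 𝒫(A + 1)` with `∅ ↦ 1` and `S ↦ S` for `S ≠ ∅`. -/
def eps {α : Type} (A : Set α) : Set (α ⊕ Unit) :=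
  {b | (∃ a ∈ A, b = Sum.inl a) ∨ (A = ∅ ∧ b = Sum.inr ())}

theorem eps_image {α β : Type} (f : α → β) (A : Set α) :
    eps (f '' A) = Sum.map f id '' eps A := by
  ext b
  constructor
  · rintro (⟨_, ⟨a, ha, rfl⟩, rfl⟩ | ⟨hA, rfl⟩)
    · exact ⟨Sum.inl a, Or.inl ⟨a, ha, rfl⟩, rfl⟩
    · exact ⟨Sum.inr (), Or.inr ⟨Set.image_eq_empty.1 hA, rfl⟩, rfl⟩
  · rintro ⟨_, ⟨a, ha, rfl⟩ | ⟨hA, rfl⟩, rfl⟩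
    · exact Or.inl ⟨f a, ⟨a, ha, rfl⟩, rfl⟩
    · exact Or.inr ⟨by rw [hA, Set.image_empty], rfl⟩

/-- The map `Σ(X × S × 𝒫T)(n) → 𝒫(Σ(X × S × (T + 1))(n))` that first applies `eps` to all sets
and then collects the elements that arise by choosing one member of each of them. -/
def distFun (X S T : Psh) (n : FinCard) : (Sig.obj (prod X (prod S (Pow.obj T)))).obj n →
    Set ((Sig.obj (prod X (prod S (coprod T one)))).obj n)
  | Sum.inl v => {Sum.inl v}
  | Sum.inr (Sum.inl (t, f, A)) => (fun b => Sum.inr (Sum.inl (t, f, b))) '' eps A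
  | Sum.inr (Sum.inr ((t₁, g, A₁), (t₂, h, A₂))) =>
      Set.image2 (fun b₁ b₂ => Sum.inr (Sum.inr ((t₁, g, b₁), (t₂, h, b₂)))) (eps A₁) (eps A₂)

theorem singleton_image {α β : Type} (f : α → β) (a : α) : ({f a} : Set β) = f '' {a} :=
  Set.image_singleton.symm

/-- `distFun` as a morphism of presheaves. -/
def dist (X S T : Psh) : Sig.obj (prod X (prod S (Pow.obj T))) ⟶
    Pow.obj (Sig.obj (prod X (prod S (coprod T one)))) :=
  mkHom (distFun X S T) (by
    rintro n m r (v | ⟨t, f, A⟩ | ⟨⟨t₁, g, A₁⟩, ⟨t₂, h, A₂⟩⟩)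
    · exact singleton_image ((Sig.obj (prod X (prod S (coprod T one)))).map r) (Sum.inl v)
    · refine Eq.trans (congrArg (Set.image _) (eps_image (T.map (lift r)) A)) ?_
      refine (Set.image_image _ _ _).trans (Eq.trans ?_ (Set.image_image _ _ _).symm)
      rfl
    · refine Eq.trans (congrArg₂ (Set.image2 _) (eps_image (T.map r) A₁)
        (eps_image (T.map r) A₂)) ?_
      refine (Set.image2_image_left _ _).trans ((Set.image2_image_right _ _).trans
        (Eq.trans ?_ (Set.image_image2 _ _).symm))
      rfl)

theorem dist_natural {X X' S S' T T' : Psh} (a : X ⟶ X') (s : S ⟶ S') (t : T ⟶ T') :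
    Sig.map (prodMap a (prodMap s (Pow.map t))) ≫ dist X' S' T' =
      dist X S T ≫ Pow.map (Sig.map (prodMap a (prodMap s (coprodMap t (𝟙 one))))) :=
  hom_ext (by
    rintro n (v | ⟨x, f, A⟩ | ⟨⟨t₁, g, A₁⟩, ⟨t₂, h, A₂⟩⟩)
    · exact singleton_image
        ((Sig.map (prodMap a (prodMap s (coprodMap t (𝟙 one))))).app n) (Sum.inl v)
    · refine Eq.trans (congrArg (Set.image _) (eps_image (t.app n.succ) A)) ?_
      refine (Set.image_image _ _ _).trans (Eq.trans ?_ (Set.image_image _ _ _).symm)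
      rfl
    · refine Eq.trans (congrArg₂ (Set.image2 _) (eps_image (t.app n) A₁)
        (eps_image (t.app n) A₂)) ?_
      refine (Set.image2_image_left _ _).trans ((Set.image2_image_right _ _).trans
        (Eq.trans ?_ (Set.image_image2 _ _).symm))
      rfl)

theorem phi_aux {α β : Type} (f : α → β) (A : Set (α ⊕ Unit)) :
    {b : β | Sum.inl b ∈ Sum.map f id '' A} = f '' {a | Sum.inl a ∈ A} := by
  refine Set.ext (fun a => ⟨?_, ?_⟩)
  · rintro ⟨x | x, hx, e⟩
    · exact ⟨x, hx, Sum.inl.inj e⟩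
    · exact absurd e (by rintro ⟨⟩)
  · rintro ⟨x, hx, rfl⟩
    exact ⟨Sum.inl x, hx, rfl⟩

/-- The map `𝒫(T + 1) → 𝒫T`, `S ↦ S ∖ {*}`. -/
def phi (T : Psh) : Pow.obj (coprod T one) ⟶ Pow.obj T :=
  mkHom (fun n (A : Set (T.obj n ⊕ Unit)) => {a | Sum.inl a ∈ A})
    (fun _ _ r A => phi_aux (T.map r) A)

theorem phi_natural {T T' : Psh} (t : T ⟶ T') :
    Pow.map (coprodMap t (𝟙 one)) ≫ phi T' = phi T ≫ Pow.map t :=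
  hom_ext (fun n A => phi_aux (t.app n) A)

/-- Extension of a morphism `Σ(X × S × (T + 1)) → T' + 1` to sets of elements of `T`. -/
def powExt {X S T T' : Psh} (u : Sig.obj (prod X (prod S (coprod T one))) ⟶ coprod T' one) :
    Sig.obj (prod X (prod S (Pow.obj T))) ⟶ Pow.obj T' :=
  dist X S T ≫ Pow.map u ≫ phi T'

theorem powExt_pre {X X' S S' T T' W : Psh} (a : X ⟶ X') (s : S ⟶ S') (t : T ⟶ T')
    (u' : Sig.obj (prod X' (prod S' (coprod T' one))) ⟶ coprod W one) :
    Sig.map (prodMap a (prodMap s (Pow.map t))) ≫ powExt u' =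
      powExt (Sig.map (prodMap a (prodMap s (coprodMap t (𝟙 one)))) ≫ u') := by
  unfold powExt
  rw [Pow.map_comp]
  simp only [Category.assoc]
  rw [← Category.assoc, dist_natural, Category.assoc]

theorem powExt_post {X S T W W' : Psh}
    (u : Sig.obj (prod X (prod S (coprod T one))) ⟶ coprod W one) (r : W ⟶ W') :
    powExt u ≫ Pow.map r = powExt (u ≫ coprodMap r (𝟙 one)) := by
  unfold powExt
  rw [Pow.map_comp]
  simp only [Category.assoc]
  rw [phi_natural]

theorem powExt_natural {X S S' T T' W W' : Psh} {s : S ⟶ S'} {t : T ⟶ T'} {r : W ⟶ W'}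
    {u : Sig.obj (prod X (prod S (coprod T one))) ⟶ coprod W one}
    {u' : Sig.obj (prod X (prod S' (coprod T' one))) ⟶ coprod W' one}
    (h : Sig.map (prodMap (𝟙 X) (prodMap s (coprodMap t (𝟙 one)))) ≫ u' =
      u ≫ coprodMap r (𝟙 one)) :
    Sig.map (prodMap (𝟙 X) (prodMap s (Pow.map t))) ≫ powExt u' = powExt u ≫ Pow.map r := by
  rw [powExt_pre, powExt_post, h]

theorem powExt_dinatural {X X' S S' T T' W W' W'' : Psh} {a : X ⟶ X'} {s : S' ⟶ S} {t : T' ⟶ T}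
    {r : W ⟶ W''} {r' : W' ⟶ W''}
    {u : Sig.obj (prod X (prod S (coprod T one))) ⟶ coprod W one}
    {u' : Sig.obj (prod X' (prod S' (coprod T' one))) ⟶ coprod W' one}
    (h : Sig.map (prodMap (𝟙 X) (prodMap s (coprodMap t (𝟙 one)))) ≫ u ≫ coprodMap r (𝟙 one) =
      Sig.map (prodMap a (𝟙 (prod S' (coprod T' one)))) ≫ u' ≫ coprodMap r' (𝟙 one)) :
    Sig.map (prodMap (𝟙 X) (prodMap s (Pow.map t))) ≫ powExt u ≫ Pow.map r =
      Sig.map (prodMap a (𝟙 (prod S' (Pow.obj T')))) ≫ powExt u' ≫ Pow.map r' := by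
  have e : (𝟙 (prod S' (coprod T' one))) = prodMap (𝟙 S') (coprodMap (𝟙 T') (𝟙 one)) :=
    hom_ext (by rintro n ⟨x, y | y⟩ <;> rfl)
  have e' : (𝟙 (prod S' (Pow.obj T'))) = prodMap (𝟙 S') (Pow.map (𝟙 T')) := by
    rw [Pow.map_id]; rfl
  rw [e', powExt_post, powExt_post, powExt_pre, powExt_pre, h, e]

/-- The reduction behaviour (second component) of the nondeterministic law. -/
def sigma (X : Under V) (Y : Psh) :
    Sig.obj (prod X.right (B.obj (op X.right, Y))) ⟶
      Pow.obj (G.obj (op X.right, Free.obj (coprod X.right Y))) :=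
  dist X.right (Sub.obj (op X.right, Y)) (G.obj (op X.right, Y)) ≫
    Pow.map (rho0.app X Y ≫ FunctorToTypes.prod.snd) ≫ phi _

theorem sigma_eq (X : Under V) (Y : Psh) : sigma X Y =
    powExt (X := X.right) (S := Sub.obj (op X.right, Y)) (T := G.obj (op X.right, Y))
      (sigma0 X Y) := rfl

theorem sigma_natural (X : Under V) {Y Y' : Psh} (k : Y ⟶ Y') :
    Sig.map (prodMap (𝟙 X.right) (B.map (𝟙 (op X.right) ×ₘ k))) ≫ sigma X Y' =
      sigma X Y ≫ Pow.map (G.map (𝟙 (op X.right) ×ₘ Free.map (coprodMap (𝟙 X.right) k))) :=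
  powExt_natural (X := X.right) (s := Sub.map (𝟙 (op X.right) ×ₘ k))
    (t := G.map (𝟙 (op X.right) ×ₘ k)) (u := sigma0 X Y) (u' := sigma0 X Y')
    (sigma0_natural X k)

theorem sigma_dinatural {X X' : Under V} (h : X ⟶ X') (Y : Psh) :
    Sig.map (prodMap (𝟙 X.right) (B.map (h.right.op ×ₘ 𝟙 Y))) ≫ sigma X Y ≫
        Pow.map (G.map (𝟙 (op X.right) ×ₘ Free.map (coprodMap h.right (𝟙 Y)))) =
      Sig.map (prodMap h.right (𝟙 (B.obj (op X'.right, Y)))) ≫ sigma X' Y ≫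
        Pow.map (G.map (h.right.op ×ₘ 𝟙 (Free.obj (coprod X'.right Y)))) :=
  powExt_dinatural (s := Sub.map (h.right.op ×ₘ 𝟙 Y)) (t := G.map (h.right.op ×ₘ 𝟙 Y))
    (u := sigma0 X Y) (u' := sigma0 X' Y) (sigma0_dinatural h Y)

/-- The higher-order GSOS law `ρ` of the call-by-name λ-calculus over `B`. -/
def rho : HOLaw B where
  app X Y := FunctorToTypes.prod.lift (Sig.map (mid _ _ _) ≫ tau X Y) (sigma X Y)
  natural X {Y Y'} k := hom_ext (by
    intro n x
    refine Prod.ext ?_ (happ (sigma_natural X k) x)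
    refine Eq.trans ?_ (happ (tau_natural X k) ((Sig.map (mid _ _ _)).app n x))
    rcases x with x | x | ⟨x, y⟩ <;> rfl)
  dinatural {X X'} h Y := hom_ext (by
    intro n x
    refine Prod.ext ?_ (happ (sigma_dinatural h Y) x)
    refine Eq.trans ?_ ((happ (tau_dinatural h Y) ((Sig.map (mid _ _ _)).app n x)).trans ?_)
    · rcases x with x | x | ⟨x, y⟩ <;> rfl
    · rcases x with x | x | ⟨x, y⟩ <;> rfl)

/-! ### λ-terms -/

/-- λ-terms modulo α-equivalence with free variables from `n`. The body of an abstraction is a term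
with free variables from `n + 1`, in which the variable `n` is the bound one. -/
inductive Tm : FinCard → Type
  | var {n : FinCard} (i : Fin n.card) : Tm n
  | lam {n : FinCard} (t : Tm n.succ) : Tm n
  | app {n : FinCard} (s t : Tm n) : Tm n

namespace Tm

/-- Renaming of free variables. -/
def rename : ∀ {n : FinCard}, Tm n → ∀ {m : FinCard}, (n ⟶ m) → Tm m
  | _, var i, _, r => var (r i)
  | _, lam t, _, r => lam (t.rename (lift r))
  | _, app s t, _, r => app (s.rename r) (t.rename r)

theorem rename_id {n : FinCard} (t : Tm n) : t.rename (𝟙 n) = t := by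
  induction t with
  | var i => rfl
  | lam t ih => simp only [rename, lift_id, ih]
  | app s t ihs iht => simp only [rename, ihs, iht]

theorem rename_comp {n m k : FinCard} (r : n ⟶ m) (s : m ⟶ k) (t : Tm n) :
    t.rename (r ≫ s) = (t.rename r).rename s := by
  induction t generalizing m k with
  | var i => rfl
  | lam t ih => simp only [rename, lift_comp, ih]
  | app s t ihs iht => simp only [rename, ihs, iht]

/-- The extension of a substitution under a binder. -/
def up {n m : FinCard} (u : Fin n.card → Tm m) : Fin n.succ.card → Tm m.succ :=
  snoc (fun i => (u i).rename (old m)) (var (Fin.last m.card))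

/-- Simultaneous capture-avoiding substitution `t[u₀, …, uₙ₋₁ / 0, …, n-1]`. -/
def subst : ∀ {n : FinCard}, Tm n → ∀ {m : FinCard}, (Fin n.card → Tm m) → Tm m
  | _, var i, _, u => u i
  | _, lam t, _, u => lam (t.subst (up u))
  | _, app s t, _, u => app (s.subst u) (t.subst u)

/-- The substitution `t[e / n]` of `e` for the last variable. -/
def inst {n : FinCard} (t : Tm n.succ) (e : Tm n) : Tm n :=
  t.subst (snoc (fun i => var i) e)

theorem up_var (n : FinCard) : up (fun i : Fin n.card => var i) = fun i => var i :=
  snoc_ext (fun i => by rw [up, snoc_castSucc]; rfl) (by rw [up, snoc_last])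

theorem subst_var {n : FinCard} (t : Tm n) : t.subst (fun i => var i) = t := by
  induction t with
  | var i => rfl
  | lam t ih => rw [subst, up_var, ih]
  | app s t ihs iht => rw [subst, ihs, iht]

theorem up_lift {n m k : FinCard} (r : n ⟶ m) (u : Fin m.card → Tm k) :
    (fun i => up u (lift r i)) = up (fun i => u (r i)) :=
  snoc_lift r (fun i => (u i).rename (old k)) (var (Fin.last k.card))

theorem subst_rename {n m k : FinCard} (r : n ⟶ m) (u : Fin m.card → Tm k) (t : Tm n) :
    (t.rename r).subst u = t.subst (fun i => u (r i)) := by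
  induction t generalizing m k with
  | var i => rfl
  | lam t ih => rw [rename, subst, ih, up_lift, subst]
  | app s t ihs iht => rw [rename, subst, ihs, iht, subst]

theorem up_rename {n m k : FinCard} (u : Fin n.card → Tm m) (r : m ⟶ k) :
    (fun i => (up u i).rename (lift r)) = up (fun i => (u i).rename r) := by
  refine (comp_snoc (fun t : Tm m.succ => t.rename (lift r)) _ _).trans ?_
  refine snoc_ext (fun i => ?_) ?_
  · rw [up, snoc_castSucc, snoc_castSucc, ← rename_comp, old_lift, rename_comp]
  · rw [up, snoc_last, snoc_last, rename, lift, snoc_last]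

theorem rename_subst {n m k : FinCard} (u : Fin n.card → Tm m) (r : m ⟶ k) (t : Tm n) :
    (t.subst u).rename r = t.subst (fun i => (u i).rename r) := by
  induction t generalizing m k with
  | var i => rfl
  | lam t ih => rw [subst, rename, ih, up_rename, subst]
  | app s t ihs iht => rw [subst, rename, ihs, iht, subst]

theorem inst_rename {n m : FinCard} (r : n ⟶ m) (t : Tm n.succ) (e : Tm n) :
    (t.inst e).rename r = (t.rename (lift r)).inst (e.rename r) := by
  rw [inst, inst, rename_subst, subst_rename, snoc_lift]
  exact congrArg t.subst (comp_snoc (fun t : Tm n => t.rename r) _ _)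

/-- The call-by-name reduction relation `t → t'`. -/
inductive Red : ∀ {n : FinCard}, Tm n → Tm n → Prop
  | app1 {n : FinCard} {s s' : Tm n} (t : Tm n) (h : Red s s') : Red (app s t) (app s' t)
  | app2 {n : FinCard} (s : Tm n.succ) (t : Tm n) : Red (app (lam s) t) (s.inst t)

/-- The reflexive transitive hull `t ⇒ t'` of reduction. -/
def Reds {n : FinCard} : Tm n → Tm n → Prop := Relation.ReflTransGen Red

theorem Red.rename {n m : FinCard} (r : n ⟶ m) {t t' : Tm n} (h : Red t t') :
    Red (t.rename r) (t'.rename r) := by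
  induction h generalizing m with
  | app1 t h ih => exact Red.app1 _ (ih r)
  | app2 s t => rw [inst_rename]; exact Red.app2 _ _

theorem Red.of_rename {n m : FinCard} (r : n ⟶ m) {t : Tm n} {s : Tm m}
    (h : Red (t.rename r) s) : ∃ t', Red t t' ∧ t'.rename r = s := by
  induction t generalizing m with
  | var i => cases h
  | lam t ih => cases h
  | app t₁ t₂ ih₁ ih₂ =>
    cases t₁ with
    | var i =>
      rcases h with ⟨_, h⟩
      cases h
    | lam t₁ =>
      cases h with
      | app1 _ h => cases h
      | app2 _ _ => exact ⟨_, Red.app2 _ _, inst_rename r _ _⟩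
    | app t₁ t₃ =>
      cases h with
      | app1 _ h =>
        obtain ⟨t', h', rfl⟩ := ih₁ r h
        exact ⟨_, Red.app1 _ h', rfl⟩

theorem Reds.rename {n m : FinCard} (r : n ⟶ m) {t t' : Tm n} (h : Reds t t') :
    Reds (t.rename r) (t'.rename r) := by
  induction h with
  | refl => exact Relation.ReflTransGen.refl
  | tail _ h ih => exact Relation.ReflTransGen.tail ih (h.rename r)

theorem Reds.of_rename {n m : FinCard} (r : n ⟶ m) {t : Tm n} {s : Tm m}
    (h : Reds (t.rename r) s) : ∃ t', Reds t t' ∧ t'.rename r = s := by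
  induction h with
  | refl => exact ⟨t, Relation.ReflTransGen.refl, rfl⟩
  | tail _ h ih =>
    obtain ⟨t', h', rfl⟩ := ih
    obtain ⟨t'', h'', e⟩ := Red.of_rename r h
    exact ⟨t'', Relation.ReflTransGen.tail h' h'', e⟩

end Tm

/-- The presheaf `Λ` of λ-terms. -/
def Lam : Psh :=
  mkPsh Tm (fun _ _ r t => t.rename r) (fun _ t => t.rename_id)
    (fun _ _ _ r s t => t.rename_comp r s)

/-- The inclusion of variables into `Λ`. -/
def lamVar : V ⟶ Lam := mkHom (fun _ i => Tm.var i) (fun _ _ _ _ => rfl)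

/-- The `Σ`-algebra structure `ι` of `Λ`. -/
def iota : Sig.obj Lam ⟶ Lam :=
  FunctorToTypes.coprod.desc lamVar
    (FunctorToTypes.coprod.desc
      (mkHom (fun _ t => Tm.lam t) (fun _ _ _ _ => rfl) : delta.obj Lam ⟶ Lam)
      (mkHom (fun _ p => Tm.app p.1 p.2) (fun _ _ _ _ => rfl) : prod Lam Lam ⟶ Lam))

/-- `Λ` as a `V`-pointed presheaf. -/
def LamPt : Under V := Under.mk lamVar

/-- The components of the morphism defined by primitive recursion. -/
def primRecFun {A : Psh} (a : Sig.obj (prod Lam A) ⟶ A) : ∀ {n : FinCard}, Tm n → A.obj n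
  | n, .var i => a.app n (sVar i)
  | n, .lam t => a.app n (sLam (X := prod Lam A) (t, primRecFun a t))
  | n, .app s t => a.app n (sApp (X := prod Lam A) (s, primRecFun a s) (t, primRecFun a t))

theorem primRecFun_rename {A : Psh} (a : Sig.obj (prod Lam A) ⟶ A) {n m : FinCard}
    (r : n ⟶ m) (t : Tm n) : primRecFun a (t.rename r) = A.map r (primRecFun a t) := by
  induction t generalizing m with
  | var i => exact nat a r (sVar i)
  | lam t ih =>
    rw [Tm.rename, primRecFun, ih]
    exact nat a r (sLam (X := prod Lam A) (t, primRecFun a t))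
  | app s t ihs iht =>
    rw [Tm.rename, primRecFun, ihs, iht]
    exact nat a r (sApp (X := prod Lam A) (s, primRecFun a s) (t, primRecFun a t))

/-- The morphism `Λ → A` defined by primitive recursion from `a : Σ(Λ × A) → A`. -/
def primRec {A : Psh} (a : Sig.obj (prod Lam A) ⟶ A) : Lam ⟶ A :=
  mkHom (fun _ t => primRecFun a t) (fun _ _ r t => primRecFun_rename a r t)

theorem primRec_comm {A : Psh} (a : Sig.obj (prod Lam A) ⟶ A) :
    iota ≫ primRec a = Sig.map (FunctorToTypes.prod.lift (𝟙 Lam) (primRec a)) ≫ a :=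
  hom_ext (by rintro n (x | x | ⟨x, y⟩) <;> rfl)

theorem primRec_unique {A : Psh} (a : Sig.obj (prod Lam A) ⟶ A) (g : Lam ⟶ A)
    (hg : iota ≫ g = Sig.map (FunctorToTypes.prod.lift (𝟙 Lam) g) ≫ a) : g = primRec a := by
  have key : ∀ (n : FinCard) (x : (Sig.obj Lam).obj n), g.app n (iota.app n x) =
      a.app n ((Sig.map (FunctorToTypes.prod.lift (𝟙 Lam) g)).app n x) := fun n x => happ hg x
  have main : ∀ (n : FinCard) (t : Tm n), g.app n t = primRecFun a t := by
    intro n t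
    induction t with
    | var i => exact key _ (sVar i)
    | lam t ih =>
      rw [primRecFun, ← ih]
      exact key _ (sLam (X := Lam) t)
    | app s t ihs iht =>
      rw [primRecFun, ← ihs, ← iht]
      exact key _ (sApp (X := Lam) s t)
  exact hom_ext main

/-- `(Λ, ι)` is the initial `Σ`-algebra. -/
theorem lam_initial {A : Psh} (a : Sig.obj A ⟶ A) :
    ∃! g : Lam ⟶ A, iota ≫ g = Sig.map g ≫ a := by
  have e : ∀ g : Lam ⟶ A, Sig.map (FunctorToTypes.prod.lift (𝟙 Lam) g) ≫
      Sig.map (FunctorToTypes.prod.snd : prod Lam A ⟶ A) ≫ a = Sig.map g ≫ a := fun g =>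
    hom_ext (by rintro n (x | x | ⟨x, y⟩) <;> rfl)
  refine ⟨primRec (Sig.map (FunctorToTypes.prod.snd : prod Lam A ⟶ A) ≫ a), ?_, fun g hg => ?_⟩
  · exact (primRec_comm _).trans (e _)
  · exact primRec_unique _ g (Eq.trans hg (e g).symm)

/-! ### The operational models -/

/-- The codiagonal `∇ : X + X → X`. -/
abbrev codiag (X : Psh) : coprod X X ⟶ X := FunctorToTypes.coprod.desc (𝟙 X) (𝟙 X)

/-- The structure map `Σ(Λ × H(Λ, Λ)) → H(Λ, Λ)` induced by a law, where `ι̂ : Σ⋆Λ → Λ` is the free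
extension of the identity. -/
def opStep {H : Pshᵒᵖ × Psh ⥤ Psh} (ρ : HOLaw H) :
    Sig.obj (prod Lam (H.obj (op Lam, Lam))) ⟶ H.obj (op Lam, Lam) :=
  ρ.app LamPt Lam ≫ H.map (𝟙 (op Lam) ×ₘ Free.map (codiag Lam)) ≫
    H.map (𝟙 (op Lam) ×ₘ freeExt iota (𝟙 Lam))

/-- The operational model `γ : Λ → H(Λ, Λ)` of a higher-order GSOS law `ρ` of `Σ` over `H`. -/
def opModel {H : Pshᵒᵖ × Psh ⥤ Psh} (ρ : HOLaw H) : Lam ⟶ H.obj (op Lam, Lam) :=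
  primRec (opStep ρ)

/-- The operational model is the unique morphism `γ` with
`γ ∘ ι = H(Λ, ι̂) ∘ H(Λ, Σ⋆∇) ∘ ρ_{Λ, Λ} ∘ Σ⟨id, γ⟩`. -/
theorem opModel_iff {H : Pshᵒᵖ × Psh ⥤ Psh} (ρ : HOLaw H) (g : Lam ⟶ H.obj (op Lam, Lam)) :
    iota ≫ g = Sig.map (FunctorToTypes.prod.lift (𝟙 Lam) g) ≫ ρ.app LamPt Lam ≫
        H.map (𝟙 (op Lam) ×ₘ Free.map (codiag Lam)) ≫
          H.map (𝟙 (op Lam) ×ₘ freeExt iota (𝟙 Lam)) ↔ g = opModel ρ :=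
  ⟨fun h => primRec_unique (opStep ρ) g h, fun h => h ▸ primRec_comm (opStep ρ)⟩

/-- The operational model `γ⁰ : Λ → ⟪Λ, Λ⟫ × ((Λ + Λ^Λ) + 1)` of `ρ⁰`. -/
def gamma0 : Lam ⟶ B0.obj (op Lam, Lam) := opModel rho0

/-- The operational model `γ : Λ → ⟪Λ, Λ⟫ × 𝒫⋆(Λ + Λ^Λ)` of `ρ`. -/
def gamma : Lam ⟶ B.obj (op Lam, Lam) := opModel rho

/-- The first component `γ₁` of `γ`. -/
def gamma1 : Lam ⟶ Sub.obj (op Lam, Lam) := gamma ≫ FunctorToTypes.prod.fst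

/-- The second component `γ⁰₂` of `γ⁰`. -/
def gamma02 : Lam ⟶ coprod (G.obj (op Lam, Lam)) one := gamma0 ≫ FunctorToTypes.prod.snd

/-- The second component of the weak operational model,
`γ̃₂(t) = {t' ∈ Λ(n) : t ⇒ t'} ∪ {f ∈ Λ^Λ(n) : ∃ t', t ⇒ t' and γ⁰₂(t') = f}`. -/
def gammaTilde2Fun (n : FinCard) (t : Tm n) : Set (Tm n ⊕ (Expo.obj (op Lam, Lam)).obj n) :=
  {x | (∃ t' : Tm n, Tm.Reds t t' ∧ x = Sum.inl t') ∨
    ∃ (t' : Tm n) (f : (Expo.obj (op Lam, Lam)).obj n), Tm.Reds t t' ∧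
      gamma02.app n t' = Sum.inl (Sum.inr f) ∧ x = Sum.inr f}

theorem gammaTilde2Fun_rename (n m : FinCard) (r : n ⟶ m) (t : Tm n) :
    gammaTilde2Fun m (t.rename r) = (G.obj (op Lam, Lam)).map r '' gammaTilde2Fun n t := by
  refine Set.ext (fun x => ⟨?_, ?_⟩)
  · rintro (⟨s, hs, rfl⟩ | ⟨s, f, hs, hf, rfl⟩)
    · obtain ⟨t', h, rfl⟩ := Tm.Reds.of_rename r hs
      exact ⟨Sum.inl t', Or.inl ⟨t', h, rfl⟩, rfl⟩
    · obtain ⟨t', h, rfl⟩ := Tm.Reds.of_rename r hs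
      have e := (nat gamma02 r t').symm.trans hf
      rcases e' : gamma02.app n t' with (y | g) | y
      · rw [e'] at e
        exact absurd (Sum.inl.inj e) (by rintro ⟨⟩)
      · rw [e'] at e
        exact ⟨Sum.inr g, Or.inr ⟨t', g, h, e', rfl⟩, Sum.inl.inj e⟩
      · rw [e'] at e
        cases e
  · rintro ⟨_, ⟨t', h, rfl⟩ | ⟨t', f, h, hf, rfl⟩, rfl⟩
    · exact Or.inl ⟨t'.rename r, h.rename r, rfl⟩
    · exact Or.inr ⟨t'.rename r, (Expo.obj (op Lam, Lam)).map r f, h.rename r,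
        (nat gamma02 r t').trans (congrArg _ hf), rfl⟩

/-- The second component `γ̃₂` of the weak operational model. -/
def gammaTilde2 : Lam ⟶ Pow.obj (G.obj (op Lam, Lam)) :=
  mkHom gammaTilde2Fun gammaTilde2Fun_rename

/-- The weak operational model `γ̃ = ⟨γ₁, γ̃₂⟩ : Λ → ⟪Λ, Λ⟫ × 𝒫⋆(Λ + Λ^Λ)`. -/
def gammaTilde : Lam ⟶ B.obj (op Lam, Lam) := FunctorToTypes.prod.lift gamma1 gammaTilde2

/-! ### Relations and relation liftings -/

/-- Relations on a presheaf `X`, that is, subpresheaves of `X × X`. -/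
abbrev Rel (X : Psh) : Type := Subfunctor (prod X X)

/-- The left projection of a relation. -/
abbrev outl {X : Psh} (R : Rel X) : R.toFunctor ⟶ X := R.ι ≫ FunctorToTypes.prod.fst

/-- The right projection of a relation. -/
abbrev outr {X : Psh} (R : Rel X) : R.toFunctor ⟶ X := R.ι ≫ FunctorToTypes.prod.snd

/-- The identity (diagonal) relation. -/
def idRel (X : Psh) : Rel X where
  obj n := {p | p.1 = p.2}
  map r := by
    rintro ⟨x, y⟩ h
    exact congrArg (X.map r) h

/-- The canonical relation lifting of a bifunctor `H`. For relations `R` on `X` and `S` on `Y` it is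
the image in `H(X, Y) × H(X, Y)` of the pullback of
`⟨H(id, outl_S), H(id, outr_S)⟩ : H(R, S) → H(R, Y) × H(R, Y)` along
`H(outl_R, id) × H(outr_R, id) : H(X, Y) × H(X, Y) → H(R, Y) × H(R, Y)`. -/
def canLift (H : Pshᵒᵖ × Psh ⥤ Psh) {X Y : Psh} (R : Rel X) (S : Rel Y) :
    Rel (H.obj (op X, Y)) where
  obj n := {p | ∃ z : (H.obj (op R.toFunctor, S.toFunctor)).obj n,
    (H.map (𝟙 (op R.toFunctor) ×ₘ outl S)).app n z = (H.map ((outl R).op ×ₘ 𝟙 Y)).app n p.1 ∧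
    (H.map (𝟙 (op R.toFunctor) ×ₘ outr S)).app n z = (H.map ((outr R).op ×ₘ 𝟙 Y)).app n p.2}
  map r := by
    rintro p ⟨z, h1, h2⟩
    refine ⟨(H.obj (op R.toFunctor, S.toFunctor)).map r z, ?_, ?_⟩
    · exact (nat _ r z).trans ((congrArg _ h1).trans (nat _ r p.1).symm)
    · exact (nat _ r z).trans ((congrArg _ h2).trans (nat _ r p.2).symm)

/-- The lifting of `𝒫⋆` by the one-sided Egli-Milner relation. -/
def powLift {X : Psh} (R : Rel X) : Rel (Pow.obj X) where
  obj n := {p : Set (X.obj n) × Set (X.obj n) | ∀ a ∈ p.1, ∃ b ∈ p.2, (a, b) ∈ R.obj n}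
  map r := by
    rintro ⟨A, A'⟩ h _ ⟨a, ha, rfl⟩
    obtain ⟨b, hb, hab⟩ := h a ha
    exact ⟨_, ⟨b, hb, rfl⟩, R.map r hab⟩

/-- The product of two relations. -/
def relProd {X Y : Psh} (R : Rel X) (S : Rel Y) : Rel (prod X Y) where
  obj n := {p | (p.1.1, p.2.1) ∈ R.obj n ∧ (p.1.2, p.2.2) ∈ S.obj n}
  map r := by
    rintro ⟨p, q⟩ ⟨h1, h2⟩
    exact ⟨R.map r h1, S.map r h2⟩

/-- The relation lifting of `B`: the product of the canonical lifting of `(X, Y) ↦ ⟪X, Y⟫` and the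
composite of the Egli-Milner lifting of `𝒫⋆` with the canonical lifting of `(X, Y) ↦ Y + Y^X`. -/
def BLift {X Y : Psh} (R : Rel X) (S : Rel Y) : Rel (B.obj (op X, Y)) :=
  relProd (canLift Sub R S) (powLift (canLift G R S))

/-! ### Weak similarity -/

/-- For `B(C, -)`-coalgebras `c` and `c'` on `C` and a relation `R` on `C`, with
`E = B̄(id_C, R)`: there is a morphism `R → E` over `c` on the left and over `c'` on the right. -/
def HasLift {C : Psh} (c c' : C ⟶ B.obj (op C, C)) (R : Rel C) : Prop :=
  ∃ h : R.toFunctor ⟶ (BLift (idRel C) R).toFunctor,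
    h ≫ outl (BLift (idRel C) R) = outl R ≫ c ∧ h ≫ outr (BLift (idRel C) R) = outr R ≫ c'

/-- Simulations on a `B(C, -)`-coalgebra. -/
def IsSimulation {C : Psh} (c : C ⟶ B.obj (op C, C)) (R : Rel C) : Prop := HasLift c c R

/-- `c'` is a weakening of `c`. -/
def IsWeakening {C : Psh} (c c' : C ⟶ B.obj (op C, C)) : Prop :=
  ∀ R : Rel C, IsSimulation c' R ↔ HasLift c c' R

/-- Weak simulations on `c` with respect to `c'`; for a weakening `c'` of `c` the two conditions are
equivalent. -/
def IsWeakSimulation {C : Psh} (c c' : C ⟶ B.obj (op C, C)) (R : Rel C) : Prop :=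
  IsSimulation c' R ∧ HasLift c c' R

/-! ### Applicative similarity -/

/-- Applicative simulations on closed terms. -/
def IsAppSimulation (R : Tm FinCard.zero → Tm FinCard.zero → Prop) : Prop :=
  ∀ t₁ t₂, R t₁ t₂ → ∀ t₁', Tm.Reds t₁ (Tm.lam t₁') →
    ∃ t₂', Tm.Reds t₂ (Tm.lam t₂') ∧ ∀ e : Tm FinCard.zero, R (t₁'.inst e) (t₂'.inst e)

/-- Applicative similarity. -/
def AppSim (t₁ t₂ : Tm FinCard.zero) : Prop := ∃ R, IsAppSimulation R ∧ R t₁ t₂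

theorem appSim_isGreatest : IsGreatest {R | IsAppSimulation R} AppSim := by
  refine ⟨?_, fun R hR t₁ t₂ h => ⟨R, hR, h⟩⟩
  rintro t₁ t₂ ⟨R, hR, h⟩ t₁' ht
  obtain ⟨t₂', h2, h3⟩ := hR t₁ t₂ h t₁' ht
  exact ⟨t₂', h2, fun e => ⟨R, hR, h3 e⟩⟩

/-- The components of the open extension of applicative similarity. -/
def OpenAppSim : ∀ n : FinCard, Tm n → Tm n → Prop
  | ⟨0⟩, t₁, t₂ => AppSim t₁ t₂
  | ⟨k + 1⟩, t₁, t₂ => ∀ u : Fin (k + 1) → Tm FinCard.zero, AppSim (t₁.subst u) (t₂.subst u)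

theorem subst_closed (t : Tm FinCard.zero) (u : Fin 0 → Tm FinCard.zero) : t.subst u = t := by
  have e : u = fun i => Tm.var i := funext (fun i => i.elim0)
  rw [e]
  exact Tm.subst_var t

theorem openAppSim_iff (n : FinCard) (t₁ t₂ : Tm n) : OpenAppSim n t₁ t₂ ↔
    ∀ u : Fin n.card → Tm FinCard.zero, AppSim (t₁.subst u) (t₂.subst u) := by
  rcases n with ⟨_ | k⟩
  · refine ⟨fun h u => ?_, fun h => ?_⟩
    · rw [subst_closed, subst_closed]; exact h
    · have := h Fin.elim0
      rw [subst_closed, subst_closed] at this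
      exact this
  · exact Iff.rfl

theorem openAppSim_rename {n m : FinCard} (r : n ⟶ m) {t₁ t₂ : Tm n} (h : OpenAppSim n t₁ t₂) :
    OpenAppSim m (t₁.rename r) (t₂.rename r) := by
  refine (openAppSim_iff m _ _).2 (fun u => ?_)
  rw [Tm.subst_rename, Tm.subst_rename]
  exact (openAppSim_iff n _ _).1 h _

/-- The open extension `≲^ap` of applicative similarity, as a relation on `Λ`. -/
def openAppSim : Rel Lam where
  obj n := {p | OpenAppSim n p.1 p.2}
  map r := by
    rintro ⟨t₁, t₂⟩ h
    exact openAppSim_rename r h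

end LambdaGSOS

namespace LambdaGSOS

/-! ### Substitution -/

namespace Tm

/-! The categorical data are first made concrete. The first component of both operational models is
simultaneous substitution (`gamma_fst`, `gamma0_fst`). The second component of `γ⁰` sends an
abstraction to the function `e ↦ t[e]`, a reducible term to its unique reduct, and every other term
to `*`. The set-valued second component of `γ` is the same partial function, its values read as sets
with at most one element (`gamma_behaviours`).

The lifting is taken over the diagonal, so it unwinds pointwise. A lift over `γ` and `γ̃` exists for
`R` iff `R` is closed under substitution, each single reduction step on the left is matched by some
`⇒` on the right, and an abstraction on the left is matched by convergence to an abstraction on the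
right, with instances of the bodies related. Simulations on `γ̃` satisfy the same clauses with `⇒`
on the left as well. The weakening property is then an induction on the length of `⇒`.

A simulation restricts at `0` to an applicative simulation, and closure under substitution carries
its open pairs there; this gives one inclusion. For the other, the hard clause is the one for an
abstraction `λ.s` related to an open term `q`. The hypothesis speaks only of closed instances, yet a
single abstraction reached from `q` itself is needed. Substituting the divergent term `Ω` for all
variables settles this: `q[Ω,…,Ω]` converges, and it could not if the evaluation of `q` got stuck on
a variable in head position (`Tm.Reds.exists_lam_of_subst_omega`). Determinism of reduction then
shows that the abstraction so found has the right closed instances. -/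

theorem up_subst {n m k : FinCard} (u : Fin n.card → Tm m) (w : Fin m.card → Tm k) :
    (fun i => (up u i).subst (up w)) = up (fun i => (u i).subst w) := by
  refine snoc_ext (fun i => ?_) ?_
  · change (snoc _ _ _ : Tm m.succ).subst _ = snoc _ _ _
    rw [snoc_castSucc, snoc_castSucc, subst_rename, rename_subst]
    exact congrArg (u i).subst (funext fun j => snoc_castSucc _ _ j)
  · change (snoc _ _ _ : Tm m.succ).subst _ = snoc _ _ _
    rw [snoc_last, snoc_last]
    exact snoc_last (fun i => (w i).rename (old k)) (Tm.var (Fin.last k.card))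

theorem subst_subst {n m k : FinCard} (u : Fin n.card → Tm m) (w : Fin m.card → Tm k)
    (t : Tm n) : (t.subst u).subst w = t.subst (fun i => (u i).subst w) := by
  induction t generalizing m k with
  | var i => rfl
  | lam t ih => rw [subst, subst, ih, up_subst, subst]
  | app s t ihs iht => rw [subst, subst, ihs, iht, subst]

theorem subst_snoc_subst {n m k : FinCard} (u : Fin n.card → Tm m) (e : Tm m)
    (w : Fin m.card → Tm k) (t : Tm n.succ) :
    (t.subst (snoc u e)).subst w = t.subst (snoc (fun i => (u i).subst w) (e.subst w)) := by
  rw [subst_subst]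
  exact congrArg t.subst (comp_snoc (fun t : Tm m => t.subst w) u e)

/-- Each `u i` is weakened by `up`, and instantiating the new variable undoes the weakening. With
this, β-reduction commutes with substitution. -/
theorem subst_up_inst {n m : FinCard} (u : Fin n.card → Tm m) (e : Tm m) (t : Tm n.succ) :
    (t.subst (up u)).inst e = t.subst (snoc u e) := by
  rw [inst, subst_subst]
  refine congrArg t.subst (snoc_ext (fun i => ?_) ?_)
  · rw [up, snoc_castSucc, snoc_castSucc, subst_rename]
    exact (congrArg (u i).subst (funext fun j => by rw [old, snoc_castSucc])).trans (subst_var _)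
  · rw [up, snoc_last, snoc_last, subst, snoc_last]

theorem inst_subst {n m : FinCard} (u : Fin n.card → Tm m) (e : Tm n) (t : Tm n.succ) :
    (t.inst e).subst u = (t.subst (up u)).inst (e.subst u) := by
  rw [subst_up_inst, inst, subst_snoc_subst]
  rfl

/-! ### Reduction -/

theorem Red.subst {n m : FinCard} (u : Fin n.card → Tm m) {t t' : Tm n} (h : Red t t') :
    Red (t.subst u) (t'.subst u) := by
  induction h generalizing m with
  | app1 t h ih => exact Red.app1 _ (ih u)
  | app2 s t => rw [inst_subst]; exact Red.app2 _ _

theorem Reds.subst {n m : FinCard} (u : Fin n.card → Tm m) {t t' : Tm n} (h : Reds t t') :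
    Reds (t.subst u) (t'.subst u) := by
  induction h with
  | refl => exact Relation.ReflTransGen.refl
  | tail _ h ih => exact Relation.ReflTransGen.tail ih (h.subst u)

/-- Call-by-name never reduces an abstraction, so the two rules for an application cannot both
apply. -/
theorem Red.deterministic {n : FinCard} {t t₁ t₂ : Tm n} (h₁ : Red t t₁) (h₂ : Red t t₂) :
    t₁ = t₂ := by
  induction h₁ generalizing t₂ with
  | app1 t h ih =>
    cases h₂ with
    | app1 _ h' => rw [ih h']
    | app2 => cases h
  | app2 s t =>
    cases h₂ with
    | app1 _ h' => cases h'
    | app2 => rfl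

theorem Reds.lam_eq {n : FinCard} {s : Tm n.succ} {t : Tm n} (h : Reds (lam s) t) :
    t = lam s := by
  rcases Relation.ReflTransGen.cases_head h with h | ⟨_, h, _⟩
  · exact h.symm
  · cases h

/-- By determinism the reducts of `t` form a chain, and abstractions are normal, so the chain
contains at most one of them. -/
theorem Reds.lam_unique {n : FinCard} {t : Tm n} {s₁ s₂ : Tm n.succ} (h₁ : Reds t (lam s₁))
    (h₂ : Reds t (lam s₂)) : s₁ = s₂ := by
  rcases Relation.ReflTransGen.total_of_right_unique (r := Red)
    (fun _ _ _ h h' => Red.deterministic h h') h₁ h₂ with h | h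
  · exact (Tm.lam.inj (Reds.lam_eq h)).symm
  · exact Tm.lam.inj (Reds.lam_eq h)

/-! ### Testing convergence of open terms with `Ω` -/

/-- The body `x x` of the self-application combinator. -/
def selfApp (n : FinCard) : Tm n.succ :=
  app (var (Fin.last n.card)) (var (Fin.last n.card))

/-- The divergent term `Ω = (λx. x x) (λx. x x)`. -/
def omega (n : FinCard) : Tm n := app (lam (selfApp n)) (lam (selfApp n))

theorem red_omega {n : FinCard} {t : Tm n} (h : Red (omega n) t) : t = omega n := by
  cases h with
  | app1 _ h => cases h
  | app2 =>
    rw [inst, selfApp, Tm.subst, Tm.subst, snoc_last]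
    rfl

/-- Terms with a variable in head position. -/
inductive Neutral {n : FinCard} : Tm n → Prop
  | var (i : Fin n.card) : Neutral (var i)
  | app {s : Tm n} (t : Tm n) (h : Neutral s) : Neutral (app s t)

/-- Only the head of an iterated application matters: it is an abstraction or a variable. In the
second case evaluation is stuck. -/
theorem progress {n : FinCard} (t : Tm n) :
    (∃ s, t = lam s) ∨ (∃ t', Red t t') ∨ Neutral t := by
  induction t with
  | var i => exact Or.inr (Or.inr (Neutral.var i))
  | lam t ih => exact Or.inl ⟨t, rfl⟩
  | app s t ih _ =>
    rcases ih with ⟨s, rfl⟩ | ⟨s', h⟩ | h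
    · exact Or.inr (Or.inl ⟨_, Red.app2 s t⟩)
    · exact Or.inr (Or.inl ⟨_, Red.app1 t h⟩)
    · exact Or.inr (Or.inr (Neutral.app t h))

/-- The instance has the form `Ω t₁ … tₖ`. Its only redex is the head `Ω`, which reduces to itself.
-/
theorem Neutral.red_subst_omega {n m : FinCard} {t : Tm n} (h : Neutral t) {t' : Tm m}
    (h' : Red (t.subst fun _ => omega m) t') : t' = t.subst fun _ => omega m := by
  induction h generalizing t' with
  | var i => exact red_omega h'
  | @app s t h ih =>
    replace h' : Red (Tm.app (s.subst fun _ => omega m) (t.subst fun _ => omega m)) t' := h'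
    change _ = Tm.app (s.subst fun _ => omega m) _
    generalize hs : s.subst (fun _ => omega m) = s₀ at h' ih
    cases h' with
    | app1 _ h' => rw [ih h']
    -- A β-step at the root would need the instance of a neutral term to be an abstraction, but it
    -- is always an application.
    | app2 s₁ => cases h <;> cases hs

theorem Neutral.not_subst_omega_reds_lam {n m : FinCard} {t : Tm n} (h : Neutral t)
    {s : Tm m.succ} : ¬ Reds (t.subst fun _ => omega m) (lam s) := by
  intro hs
  have key : ∀ t' : Tm m, Reds (t.subst fun _ => omega m) t' →
      t' = t.subst fun _ => omega m := by
    intro t' h'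
    induction h' with
    | refl => rfl
    | tail _ h' ih => subst ih; exact h.red_subst_omega h'
  have e := key _ hs
  cases h <;> cases e

/-- A term whose instance at `Ω` converges converges itself. -/
theorem Reds.exists_lam_of_subst_omega {n m : FinCard} {t : Tm n} {s : Tm m.succ}
    (h : Reds (t.subst fun _ => omega m) (lam s)) : ∃ s', Reds t (lam s') := by
  generalize ht : t.subst (fun _ => omega m) = t₀ at h
  -- The reduction of the instance is replayed on `t` from its first step, hence induction from the
  -- head.
  induction h using Relation.ReflTransGen.head_induction_on generalizing t with
  | refl =>
    rcases progress t with ⟨s', rfl⟩ | ⟨t', h⟩ | h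
    · exact ⟨s', Relation.ReflTransGen.refl⟩
    -- Impossible: the instance is already an abstraction, so it has no reduct.
    · have := h.subst (fun _ => omega m)
      rw [ht] at this
      cases this
    · exact (h.not_subst_omega_reds_lam (s := s) (by rw [ht]; exact Relation.ReflTransGen.refl)).elim
  | head h₁ h₂ ih =>
    rcases progress t with ⟨s', rfl⟩ | ⟨t', h⟩ | h
    · exact ⟨s', Relation.ReflTransGen.refl⟩
    · have := h.subst (fun _ => omega m)
      rw [ht] at this
      -- By determinism the instance of `t'` is the actual next term of the given reduction.
      obtain ⟨s', hs'⟩ := ih (this.deterministic h₁)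
      exact ⟨s', Relation.ReflTransGen.head h hs'⟩
    · subst ht
      exact (h.not_subst_omega_reds_lam (Relation.ReflTransGen.head h₁ h₂)).elim

end Tm

/-! ### The operational models in terms of substitution and reduction -/

/-- The function `e ↦ t[e]` denoted by the abstraction `λ.t`. -/
def absFun {n : FinCard} (t : Tm n.succ) : (Expo.obj (op Lam, Lam)).obj n :=
  mkExp (X := Lam) (Y := Lam)
    (fun _ r e => t.subst (snoc (fun i => Tm.var (r i)) e))
    (fun m _ r s e => ((Tm.rename_subst (snoc (fun i => Tm.var (r i)) e) s t).trans
      (congrArg t.subst (comp_snoc (fun x : Tm m => x.rename s) _ e))).symm)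

/-- The map `u ↦ t[u]`. -/
def substHom {n : FinCard} (t : Tm n) : power Lam n ⟶ Lam :=
  mkHom (fun m (u : Fin n.card → Tm m) => t.subst u)
    (fun _ _ r u => (Tm.rename_subst u r t).symm)

/-- The three clauses of `tau` mirror those of `Tm.subst`; in particular `rho1` performs the
extension `Tm.up` under a binder. -/
theorem gamma_fst {n : FinCard} (t : Tm n) : (gamma.app n t).1 = substHom t := by
  induction t with
  | var i => rfl
  | @lam n t ih =>
    refine hom_ext fun m u => ?_
    exact congrArg Tm.lam (happ ih _)
  | @app n s t ihs iht =>
    refine hom_ext fun m u => ?_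
    exact congrArg₂ Tm.app (happ ihs _) (happ iht _)

theorem gamma0_fst {n : FinCard} (t : Tm n) : (gamma0.app n t).1 = substHom t := by
  induction t with
  | var i => rfl
  | @lam n t ih =>
    refine hom_ext fun m u => ?_
    exact congrArg Tm.lam (happ ih _)
  | @app n s t ihs iht =>
    refine hom_ext fun m u => ?_
    exact congrArg₂ Tm.app (happ ihs _) (happ iht _)

theorem gamma02_var {n : FinCard} (i : Fin n.card) :
    gamma02.app n (Tm.var i) = Sum.inr () := rfl

theorem gamma02_lam {n : FinCard} (t : Tm n.succ) :
    gamma02.app n (Tm.lam t) = Sum.inl (Sum.inr (absFun t)) := by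
  refine congrArg (fun z => Sum.inl (Sum.inr z)) (exp_ext fun m r e => ?_)
  -- `rho2` evaluates the first component of the body, which is substitution, at the tuple of
  -- variables followed by `e`.
  exact happ (gamma0_fst t) _

theorem gamma02_app {n : FinCard} (s t : Tm n) : gamma02.app n (Tm.app s t) =
    match gamma02.app n s with
    | Sum.inl (Sum.inl s') => Sum.inl (Sum.inl (Tm.app s' t))
    | Sum.inl (Sum.inr k) => Sum.inl (Sum.inl (ev (X := Lam) (Y := Lam) k t))
    | Sum.inr _ => Sum.inr () := by
  -- One unfolding of the recursion, with the behaviour of the operator `s` exposed for case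
  -- distinction.
  have e : gamma02.app n (Tm.app s t) =
      (coprodMap (G.map (𝟙 (op Lam) ×ₘ freeExt iota (𝟙 Lam))) (𝟙 one)).app n
        ((coprodMap (G.map (𝟙 (op Lam) ×ₘ Free.map (codiag Lam))) (𝟙 one)).app n
          (sigma0Fun LamPt Lam n (sApp (X := prod Lam (B0.obj (op Lam, Lam)))
            (s, (gamma0.app n s).1, gamma02.app n s) (t, gamma0.app n t)))) := rfl
  rw [e]
  rcases gamma02.app n s with (s' | k) | _ <;> rfl

theorem gamma02_eq_inl_inr {n : FinCard} {t : Tm n} {f : (Expo.obj (op Lam, Lam)).obj n} :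
    gamma02.app n t = Sum.inl (Sum.inr f) ↔ ∃ s, t = Tm.lam s ∧ f = absFun s := by
  constructor
  · intro h
    cases t with
    | var i => cases (gamma02_var i).symm.trans h
    | lam t => exact ⟨t, rfl, (Sum.inr.inj (Sum.inl.inj ((gamma02_lam t).symm.trans h))).symm⟩
    | app s t =>
      replace h := (gamma02_app s t).symm.trans h
      rcases hs : gamma02.app n s with (s' | k) | _ <;> rw [hs] at h <;> cases h
  · rintro ⟨s, rfl, rfl⟩
    exact gamma02_lam s

theorem gamma02_eq_inl_inl {n : FinCard} {t t' : Tm n} :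
    gamma02.app n t = Sum.inl (Sum.inl t') ↔ Tm.Red t t' := by
  induction t with
  | var i => exact ⟨fun h => (by cases (gamma02_var i).symm.trans h), fun h => (by cases h)⟩
  | lam t ih =>
    exact ⟨fun h => (by cases (gamma02_lam t).symm.trans h), fun h => (by cases h)⟩
  | @app n s t ihs _ =>
    constructor
    · intro h
      replace h := (gamma02_app s t).symm.trans h
      rcases hs : gamma02.app n s with (s' | k) | _ <;> rw [hs] at h
      · cases h
        exact Tm.Red.app1 t (ihs.1 hs)
      -- Function behaviour occurs only for abstractions, and evaluating `absFun s` at `t` gives the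
      -- β-reduct `s.inst t`.
      · obtain ⟨s, rfl, rfl⟩ := gamma02_eq_inl_inr.1 hs
        cases h
        exact Tm.Red.app2 s t
      · cases h
    · intro h
      refine (gamma02_app s t).trans ?_
      cases h with
      | app1 _ h => rw [ihs.2 h]; rfl
      | app2 s => rw [gamma02_lam]; rfl

/-! ### Comparison of `γ` with `γ⁰` -/

/-- The set of one-step behaviours of a term under a coalgebra over `B`. -/
abbrev behaviours {C : Psh} (c : C ⟶ B.obj (op C, C)) (n : FinCard) (t : C.obj n) :
    Set (C.obj n ⊕ (Expo.obj (op C, C)).obj n) := (c.app n t).2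

/-- Removing `*` from a singleton loses nothing, since `eps` puts it back exactly when the set has
become empty. This keeps the sets of choices singletons throughout the recursion. -/
theorem eps_setOf_eq_inl {α : Type} (x : α ⊕ Unit) : eps {a | x = Sum.inl a} = {x} := by
  refine Set.ext fun b => ⟨?_, ?_⟩
  · rintro (⟨a, ha, rfl⟩ | ⟨h, rfl⟩)
    · exact ha.symm
    · rcases x with a | _
      · exact ((Set.ext_iff.1 h a).1 rfl).elim
      · rfl
  · rintro rfl
    rcases b with a | _
    · exact Or.inl ⟨a, rfl, rfl⟩
    · exact Or.inr ⟨Set.eq_empty_iff_forall_notMem.2 fun a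
      (h : _ = _) => (by cases h), rfl⟩

theorem image_setOf_inl_mem_image_singleton {α β γ : Type} (u : α → β ⊕ Unit) (g : β → γ)
    (x : α) : g '' {b | Sum.inl b ∈ u '' {x}} = {c | Sum.map g id (u x) = Sum.inl c} := by
  rw [Set.image_singleton]
  refine Set.ext fun c => ⟨?_, ?_⟩
  · rintro ⟨b, hb, rfl⟩
    exact (congrArg (Sum.map g id) (show _ = _ from hb)).symm
  · intro h
    rcases hx : u x with b | _
    · have h' : Sum.map g id (u x) = Sum.inl c := h
      rw [hx] at h'
      exact ⟨b, show _ = _ from rfl, Sum.inl.inj h'⟩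
    · have h' : Sum.map g id (u x) = Sum.inl c := h
      rw [hx] at h'
      cases h'

/-- The inductive step common to the three term constructors. Both laws apply the same function
`sigma0Fun`, so agreement of the models at a term reduces to there being exactly one choice of
argument, the one used by `γ⁰`. -/
theorem gamma_behaviours_of_distFun_eq {n : FinCard} {x : (Sig.obj Lam).obj n}
    (h : distFun Lam (Sub.obj (op Lam, Lam)) (G.obj (op Lam, Lam)) n
        ((Sig.map (FunctorToTypes.prod.lift (𝟙 Lam) gamma)).app n x) =
      {(Sig.map (FunctorToTypes.prod.lift (𝟙 Lam) gamma0)).app n x}) :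
    behaviours gamma n (iota.app n x) = {a | gamma02.app n (iota.app n x) = Sum.inl a} := by
  -- The interpretation of formal terms over `Λ + Λ` in `Λ`, by the codiagonal followed by `ι̂`.
  let g : (G.obj (op Lam, Free.obj (coprod Lam Lam))).obj n → (G.obj (op Lam, Lam)).obj n :=
    fun a => (G.map (𝟙 (op Lam) ×ₘ freeExt iota (𝟙 Lam))).app n
      ((G.map (𝟙 (op Lam) ×ₘ Free.map (codiag Lam))).app n a)
  have e : behaviours gamma n (iota.app n x) = g '' {b | Sum.inl b ∈
      sigma0Fun LamPt Lam n '' distFun Lam (Sub.obj (op Lam, Lam)) (G.obj (op Lam, Lam)) n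
        ((Sig.map (FunctorToTypes.prod.lift (𝟙 Lam) gamma)).app n x)} :=
    (congrArg Prod.snd (happ (primRec_comm (opStep rho)) x)).trans (Set.image_image _ _ _)
  have e' : gamma02.app n (iota.app n x) = Sum.map g id
      (sigma0Fun LamPt Lam n ((Sig.map (FunctorToTypes.prod.lift (𝟙 Lam) gamma0)).app n x)) :=
    (congrArg Prod.snd (happ (primRec_comm (opStep rho0)) x)).trans (Sum.map_map _ _ _ _ _)
  rw [e, e', h]
  exact image_setOf_inl_mem_image_singleton (sigma0Fun LamPt Lam n) g _

theorem gamma_behaviours {n : FinCard} (t : Tm n) :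
    behaviours gamma n t = {a | gamma02.app n t = Sum.inl a} := by
  -- The arguments of the laws also record first components, so these must agree before the choices
  -- can be compared.
  have hfst : ∀ {n : FinCard} (t : Tm n), (gamma.app n t).1 = (gamma0.app n t).1 :=
    fun t => (gamma_fst t).trans (gamma0_fst t).symm
  induction t with
  | var i => exact gamma_behaviours_of_distFun_eq (x := sVar i) rfl
  | @lam n t ih =>
    refine gamma_behaviours_of_distFun_eq (x := sLam (X := Lam) t) ?_
    change (fun b => Sum.inr (Sum.inl (t, (gamma.app n.succ t).1, b))) ''
      eps (behaviours gamma n.succ t) = _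
    rw [(congrArg eps ih).trans (eps_setOf_eq_inl _), hfst]
    exact Set.image_singleton
  | @app n s t ihs iht =>
    refine gamma_behaviours_of_distFun_eq (x := sApp (X := Lam) s t) ?_
    change Set.image2 (fun b₁ b₂ => Sum.inr (Sum.inr ((s, (gamma.app n s).1, b₁),
      (t, (gamma.app n t).1, b₂)))) (eps (behaviours gamma n s)) (eps (behaviours gamma n t)) = _
    rw [(congrArg eps ihs).trans (eps_setOf_eq_inl _),
      (congrArg eps iht).trans (eps_setOf_eq_inl _), hfst, hfst]
    exact Set.image2_singleton

theorem gammaTilde_fst {n : FinCard} (t : Tm n) : (gammaTilde.app n t).1 = substHom t :=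
  gamma_fst t

/-! ### The lifted relations, elementwise -/

section Lifting

variable {X Y : Psh} (R : Rel Y) {n : FinCard}

theorem mem_canLift_Sub {f g : power X n ⟶ Y} :
    ((f, g) : (Sub.obj (op X, Y)).obj n × (Sub.obj (op X, Y)).obj n) ∈
        (canLift Sub (idRel X) R).obj n ↔
      ∀ m (u : Fin n.card → X.obj m), (f.app m (tup u), g.app m (tup u)) ∈ R.obj m := by
  constructor
  · rintro ⟨(z : power (idRel X).toFunctor n ⟶ R.toFunctor), hf, hg⟩ m u
    -- Evaluation at the diagonal tuple over `u` recovers both `f(u)` and `g(u)` from `z`.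
    let v : (power (idRel X).toFunctor n).obj m := fun i => ⟨(u i, u i), rfl⟩
    have hf' : (z.app m v).1.1 = f.app m (tup u) := happ hf v
    have hg' : (z.app m v).1.2 = g.app m (tup u) := happ hg v
    rw [← hf', ← hg']
    exact (z.app m v).2
  · intro h
    have e : ∀ m (u : Fin n.card → (idRel X).toFunctor.obj m),
        (fun i => (u i).1.1) = (fun i => (u i).1.2) := fun m u => funext fun i => (u i).2
    -- The witness reads left coordinates only. The left equation is then definitional, and the
    -- right one holds because diagonal pairs have equal coordinates.
    let z : power (idRel X).toFunctor n ⟶ R.toFunctor :=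
      mkHom (fun m (u : Fin n.card → (idRel X).toFunctor.obj m) =>
          ⟨(f.app m (tup fun i => (u i).1.1), g.app m (tup fun i => (u i).1.1)),
            h m fun i => (u i).1.1⟩)
        (fun m k r u => Subtype.ext (Prod.ext (nat f r _) (nat g r _)))
    refine ⟨z, rfl, ?_⟩
    refine hom_ext fun m u => ?_
    exact congrArg (g.app m) (e m u)

theorem mem_canLift_G_inl_inl {x y : Y.obj n} :
    ((Sum.inl x, Sum.inl y) : (G.obj (op X, Y)).obj n × (G.obj (op X, Y)).obj n) ∈
        (canLift G (idRel X) R).obj n ↔ (x, y) ∈ R.obj n := by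
  constructor
  · rintro ⟨z | z, h, h'⟩
    · have hx : z.1.1 = x := Sum.inl.inj h
      have hy : z.1.2 = y := Sum.inl.inj h'
      rw [← hx, ← hy]
      exact z.2
    · cases h
  · intro h
    exact ⟨Sum.inl ⟨(x, y), h⟩, rfl, rfl⟩

theorem mem_canLift_G_inr_inr {f g : (Expo.obj (op X, Y)).obj n} :
    ((Sum.inr f, Sum.inr g) : (G.obj (op X, Y)).obj n × (G.obj (op X, Y)).obj n) ∈
        (canLift G (idRel X) R).obj n ↔
      ∀ m (r : n ⟶ m) (e : X.obj m), (expApp (X := X) (Y := Y) f r e,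
        expApp (X := X) (Y := Y) g r e) ∈ R.obj m := by
  constructor
  · rintro ⟨z | z, h, h'⟩ m r e
    · cases h
    · let v : (idRel X).toFunctor.obj m := ⟨(e, e), rfl⟩
      have hf := congrArg (fun k => expApp (X := (idRel X).toFunctor) (Y := Y) k r v)
        (Sum.inr.inj h)
      have hg := congrArg (fun k => expApp (X := (idRel X).toFunctor) (Y := Y) k r v)
        (Sum.inr.inj h')
      let w : R.toFunctor.obj m :=
        expApp (X := (idRel X).toFunctor) (Y := R.toFunctor) z r v
      have hf' : w.1.1 = expApp (X := X) (Y := Y) f r e := hf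
      have hg' : w.1.2 = expApp (X := X) (Y := Y) g r e := hg
      rw [← hf', ← hg']
      exact w.2
  · intro h
    let z : (Expo.obj (op (idRel X).toFunctor, R.toFunctor)).obj n :=
      mkExp (X := (idRel X).toFunctor) (Y := R.toFunctor)
        (fun m r e => ⟨(expApp (X := X) (Y := Y) f r e.1.1,
          expApp (X := X) (Y := Y) g r e.1.1), h m r e.1.1⟩)
        (fun m k r s e => Subtype.ext (Prod.ext (expApp_nat (X := X) (Y := Y) f r s _)
          (expApp_nat (X := X) (Y := Y) g r s _)))
    refine ⟨Sum.inr z, rfl, congrArg Sum.inr (exp_ext fun m r e => ?_)⟩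
    exact congrArg (expApp (X := X) (Y := Y) g r) e.2

/-- The lifting of a coproduct never relates different summands. Hence the Egli–Milner condition
splits into one for terms and one for functions. -/
theorem exists_inl_of_mem_canLift_G {x : Y.obj n} {b : (G.obj (op X, Y)).obj n}
    (h : ((Sum.inl x, b) : (G.obj (op X, Y)).obj n × (G.obj (op X, Y)).obj n) ∈
      (canLift G (idRel X) R).obj n) : ∃ y : Y.obj n, b = Sum.inl y := by
  obtain ⟨z | z, h, h'⟩ := h
  · rcases b with y | g
    · exact ⟨y, rfl⟩
    · cases h'
  · cases h

theorem exists_inr_of_mem_canLift_G {f : (Expo.obj (op X, Y)).obj n}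
    {b : (G.obj (op X, Y)).obj n}
    (h : ((Sum.inr f, b) : (G.obj (op X, Y)).obj n × (G.obj (op X, Y)).obj n) ∈
      (canLift G (idRel X) R).obj n) :
    ∃ g : (Expo.obj (op X, Y)).obj n, b = Sum.inr g := by
  obtain ⟨z | z, h, h'⟩ := h
  · cases h
  · rcases b with y | g
    · cases h'
    · exact ⟨g, rfl⟩

end Lifting

/-- The lifted relation is a subpresheaf of a product, so the two projections determine the lift,
and its naturality is inherited from `c` and `c'`. -/
theorem hasLift_iff_forall {C : Psh} (c c' : C ⟶ B.obj (op C, C)) (R : Rel C) :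
    HasLift c c' R ↔ ∀ n (p q : C.obj n), (p, q) ∈ R.obj n →
      (c.app n p, c'.app n q) ∈ (BLift (idRel C) R).obj n := by
  constructor
  · rintro ⟨h, hl, hr⟩ n p q hpq
    let x : R.toFunctor.obj n := ⟨(p, q), hpq⟩
    have hl' : (h.app n x).1.1 = c.app n p := happ hl x
    have hr' : (h.app n x).1.2 = c'.app n q := happ hr x
    rw [← hl', ← hr']
    exact (h.app n x).2
  · intro h
    exact ⟨mkHom (fun n x => ⟨(c.app n x.1.1, c'.app n x.1.2), h n _ _ x.2⟩)
      (fun n m r x => Subtype.ext (Prod.ext (nat c r _) (nat c' r _))), rfl, rfl⟩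

/-- Existence of a lift, elementwise, for coalgebras on `Λ` whose first component is
substitution. -/
theorem hasLift_iff {c c' : Lam ⟶ B.obj (op Lam, Lam)}
    (hc : ∀ n (t : Tm n), (c.app n t).1 = substHom t)
    (hc' : ∀ n (t : Tm n), (c'.app n t).1 = substHom t) (R : Rel Lam) :
    HasLift c c' R ↔ ∀ n (p q : Tm n), (p, q) ∈ R.obj n →
      (∀ m (u : Fin n.card → Tm m), (p.subst u, q.subst u) ∈ R.obj m) ∧
      (∀ p', Sum.inl p' ∈ behaviours c n p → ∃ q', Sum.inl q' ∈ behaviours c' n q ∧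
        (p', q') ∈ R.obj n) ∧
      ∀ f, Sum.inr f ∈ behaviours c n p → ∃ g, Sum.inr g ∈ behaviours c' n q ∧
          ∀ m (r : n ⟶ m) (e : Tm m), (expApp (X := Lam) (Y := Lam) f r e,
            expApp (X := Lam) (Y := Lam) g r e) ∈ R.obj m := by
  rw [hasLift_iff_forall]
  refine forall_congr' fun n => forall_congr' fun p => forall_congr' fun q =>
    imp_congr_right fun _ => ?_
  refine and_congr ?_ ⟨fun h => ⟨fun p' hp => ?_, fun f hf => ?_⟩, ?_⟩
  · change ((c.app n p).1, (c'.app n q).1) ∈ (canLift Sub (idRel Lam) R).obj n ↔ _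
    refine (iff_of_eq (congrArg₂ (fun a b => (a, b) ∈ (canLift Sub (idRel Lam) R).obj n)
      (hc n p) (hc' n q))).trans ?_
    exact mem_canLift_Sub R
  · obtain ⟨b, hb, hpb⟩ := h _ hp
    obtain ⟨q', rfl⟩ := exists_inl_of_mem_canLift_G R hpb
    exact ⟨q', hb, (mem_canLift_G_inl_inl R).1 hpb⟩
  · obtain ⟨b, hb, hfb⟩ := h _ hf
    obtain ⟨g, rfl⟩ := exists_inr_of_mem_canLift_G R hfb
    exact ⟨g, hb, (mem_canLift_G_inr_inr R).1 hfb⟩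
  · rintro ⟨h₁, h₂⟩ (p' | f) ha
    · obtain ⟨q', hq, h⟩ := h₁ p' ha
      exact ⟨Sum.inl q', hq, (mem_canLift_G_inl_inl R).2 h⟩
    · obtain ⟨g, hg, h⟩ := h₂ f ha
      exact ⟨Sum.inr g, hg, (mem_canLift_G_inr_inr R).2 h⟩

/-! ### Weak simulations in terms of reduction -/

theorem inl_mem_gamma {n : FinCard} {t t' : Tm n} :
    Sum.inl t' ∈ behaviours gamma n t ↔ Tm.Red t t' := by
  rw [gamma_behaviours]
  exact gamma02_eq_inl_inl

theorem inr_mem_gamma {n : FinCard} {t : Tm n} {f : (Expo.obj (op Lam, Lam)).obj n} :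
    Sum.inr f ∈ behaviours gamma n t ↔ ∃ s, t = Tm.lam s ∧ f = absFun s := by
  rw [gamma_behaviours]
  exact gamma02_eq_inl_inr

theorem inl_mem_gammaTilde {n : FinCard} {t t' : Tm n} :
    Sum.inl t' ∈ behaviours gammaTilde n t ↔ Tm.Reds t t' := by
  constructor
  · rintro (⟨s, h, e⟩ | ⟨s, f, -, -, e⟩)
    · cases e
      exact h
    · cases e
  · exact fun h => Or.inl ⟨t', h, rfl⟩

theorem inr_mem_gammaTilde {n : FinCard} {t : Tm n} {f : (Expo.obj (op Lam, Lam)).obj n} :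
    Sum.inr f ∈ behaviours gammaTilde n t ↔ ∃ s, Tm.Reds t (Tm.lam s) ∧ f = absFun s := by
  constructor
  · rintro (⟨s, h, e⟩ | ⟨t', g, h, hg, e⟩)
    · cases e
    · cases e
      obtain ⟨s, rfl, rfl⟩ := gamma02_eq_inl_inr.1 hg
      exact ⟨s, h, rfl⟩
  · rintro ⟨s, h, rfl⟩
    exact Or.inr ⟨_, _, h, gamma02_lam s, rfl⟩

/-- Existence of a lift over `γ` and `γ̃`, in terms of substitution and reduction. -/
theorem hasLift_gamma_gammaTilde_iff (R : Rel Lam) : HasLift gamma gammaTilde R ↔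
    ∀ n (p q : Tm n), (p, q) ∈ R.obj n →
      (∀ m (u : Fin n.card → Tm m), (p.subst u, q.subst u) ∈ R.obj m) ∧
      (∀ p', Tm.Red p p' → ∃ q', Tm.Reds q q' ∧ (p', q') ∈ R.obj n) ∧
      ∀ s, p = Tm.lam s → ∃ s', Tm.Reds q (Tm.lam s') ∧ ∀ m (r : n ⟶ m) (e : Tm m),
        (s.subst (snoc (fun i => Tm.var (r i)) e), s'.subst (snoc (fun i => Tm.var (r i)) e)) ∈
          R.obj m := by
  rw [hasLift_iff (fun _ => gamma_fst) (fun _ => gammaTilde_fst)]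
  simp only [inr_mem_gamma, inr_mem_gammaTilde]
  refine forall_congr' fun n => forall_congr' fun p => forall_congr' fun q =>
    imp_congr_right fun _ => and_congr_right' (and_congr (forall_congr' fun p' =>
      imp_congr inl_mem_gamma (exists_congr fun q' => and_congr_left' inl_mem_gammaTilde)) ⟨?_, ?_⟩)
  · rintro h s rfl
    obtain ⟨_, ⟨s', hs', rfl⟩, h'⟩ := h _ ⟨s, rfl, rfl⟩
    exact ⟨s', hs', h'⟩
  · rintro h _ ⟨s, rfl, rfl⟩
    obtain ⟨s', hs', h'⟩ := h s rfl
    exact ⟨_, ⟨s', hs', rfl⟩, h'⟩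

/-- Simulations on `γ̃`, in terms of substitution and reduction. -/
theorem isSimulation_gammaTilde_iff (R : Rel Lam) : IsSimulation gammaTilde R ↔
    ∀ n (p q : Tm n), (p, q) ∈ R.obj n →
      (∀ m (u : Fin n.card → Tm m), (p.subst u, q.subst u) ∈ R.obj m) ∧
      (∀ p', Tm.Reds p p' → ∃ q', Tm.Reds q q' ∧ (p', q') ∈ R.obj n) ∧
      ∀ s, Tm.Reds p (Tm.lam s) → ∃ s', Tm.Reds q (Tm.lam s') ∧ ∀ m (r : n ⟶ m) (e : Tm m),
        (s.subst (snoc (fun i => Tm.var (r i)) e), s'.subst (snoc (fun i => Tm.var (r i)) e)) ∈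
          R.obj m := by
  rw [IsSimulation, hasLift_iff (fun _ => gammaTilde_fst) (fun _ => gammaTilde_fst)]
  simp only [inr_mem_gammaTilde]
  refine forall_congr' fun n => forall_congr' fun p => forall_congr' fun q =>
    imp_congr_right fun _ => and_congr_right' (and_congr (forall_congr' fun p' =>
      imp_congr inl_mem_gammaTilde (exists_congr fun q' => and_congr_left' inl_mem_gammaTilde)) ⟨?_, ?_⟩)
  · rintro h s hs
    obtain ⟨_, ⟨s', hs', rfl⟩, h'⟩ := h _ ⟨s, hs, rfl⟩
    exact ⟨s', hs', h'⟩
  · rintro h _ ⟨s, hs, rfl⟩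
    obtain ⟨s', hs', h'⟩ := h s hs
    exact ⟨_, ⟨s', hs', rfl⟩, h'⟩

theorem isWeakening_gammaTilde : IsWeakening gamma gammaTilde := by
  intro R
  rw [isSimulation_gammaTilde_iff, hasLift_gamma_gammaTilde_iff]
  constructor
  · intro h n p q hpq
    obtain ⟨h₁, h₂, h₃⟩ := h n p q hpq
    exact ⟨h₁, fun p' hp => h₂ p' (Relation.ReflTransGen.single hp),
      fun s hs => h₃ s (hs ▸ Relation.ReflTransGen.refl)⟩
  · intro h n p q hpq
    -- Answers to single steps are concatenated along the reduction of `p`.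
    have key : ∀ p', Tm.Reds p p' → ∃ q', Tm.Reds q q' ∧ (p', q') ∈ R.obj n := by
      intro p' hp
      induction hp with
      | refl => exact ⟨q, Relation.ReflTransGen.refl, hpq⟩
      | tail _ hp ih =>
        obtain ⟨q', hq, h'⟩ := ih
        obtain ⟨q'', hq', h''⟩ := (h n _ _ h').2.1 _ hp
        exact ⟨q'', hq.trans hq', h''⟩
    refine ⟨(h n p q hpq).1, key, fun s hs => ?_⟩
    obtain ⟨q', hq, h'⟩ := key _ hs
    obtain ⟨s', hs', h''⟩ := (h n _ _ h').2.2 s rfl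
    exact ⟨s', hq.trans hs', h''⟩

/-! ### Applicative similarity -/

/-- Replacing the left term by a reduct only removes obligations: each abstraction reached from the
reduct is also reached from the original term. No determinism is needed. -/
theorem AppSim.of_red {t t' q : Tm FinCard.zero} (h : AppSim t q) (ht : Tm.Red t t') :
    AppSim t' q := by
  refine ⟨fun a b => ∃ a₀, Tm.Reds a₀ a ∧ AppSim a₀ b, ?_,
    t, Relation.ReflTransGen.single ht, h⟩
  rintro a b ⟨a₀, ha, hab⟩ s hs
  obtain ⟨s', hs', h'⟩ := appSim_isGreatest.1 a₀ b hab s (ha.trans hs)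
  exact ⟨s', hs', fun e => ⟨_, Relation.ReflTransGen.refl, h' e⟩⟩

theorem openAppSim_subst {n m : FinCard} {p q : Tm n} (h : OpenAppSim n p q)
    (u : Fin n.card → Tm m) : OpenAppSim m (p.subst u) (q.subst u) := by
  refine (openAppSim_iff m _ _).2 fun w => ?_
  rw [Tm.subst_subst, Tm.subst_subst]
  exact (openAppSim_iff n _ _).1 h _

theorem OpenAppSim.of_red {n : FinCard} {p p' q : Tm n} (h : OpenAppSim n p q)
    (hp : Tm.Red p p') : OpenAppSim n p' q :=
  (openAppSim_iff n _ _).2 fun u => ((openAppSim_iff n _ _).1 h u).of_red (hp.subst u)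

theorem OpenAppSim.exists_reds_lam {n : FinCard} {s : Tm n.succ} {q : Tm n}
    (h : OpenAppSim n (Tm.lam s) q) : ∃ s', Tm.Reds q (Tm.lam s') ∧
      ∀ m (r : n ⟶ m) (e : Tm m), OpenAppSim m (s.subst (snoc (fun i => Tm.var (r i)) e))
        (s'.subst (snoc (fun i => Tm.var (r i)) e)) := by
  have key : ∀ u : Fin n.card → Tm FinCard.zero, ∃ s', Tm.Reds (q.subst u) (Tm.lam s') ∧
      ∀ e, AppSim ((s.subst (Tm.up u)).inst e) (s'.inst e) := fun u =>
    appSim_isGreatest.1 _ _ ((openAppSim_iff n _ _).1 h u) _ Relation.ReflTransGen.refl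
  -- The closed instance at `Ω` serves only to show that the open term `q` converges.
  obtain ⟨_, h₀, -⟩ := key fun _ => Tm.omega FinCard.zero
  obtain ⟨s', hs'⟩ := h₀.exists_lam_of_subst_omega
  refine ⟨s', hs', fun m r e => (openAppSim_iff m _ _).2 fun w => ?_⟩
  obtain ⟨s₁, h₁, h₂⟩ := key fun i => w (r i)
  -- The instance of `q` reaches both the abstraction supplied by similarity and the instance of
  -- `λ.s'`. Their bodies coincide, so one `s'` serves every closing substitution.
  obtain rfl := h₁.lam_unique (hs'.subst fun i => w (r i))
  have h₃ := h₂ (e.subst w)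
  rw [Tm.subst_up_inst, Tm.subst_up_inst] at h₃
  rw [Tm.subst_snoc_subst, Tm.subst_snoc_subst]
  exact h₃

/-- The open extension of applicative similarity is a weak simulation. -/
theorem isWeakSimulation_openAppSim : IsWeakSimulation gamma gammaTilde openAppSim := by
  have h : HasLift gamma gammaTilde openAppSim :=
    (hasLift_gamma_gammaTilde_iff _).2 fun n p q (h : OpenAppSim n p q) =>
      ⟨fun m u => openAppSim_subst h u,
        -- A reduction on the left is answered by no step at all.
        fun p' hp => ⟨q, Relation.ReflTransGen.refl, h.of_red hp⟩,
        fun s hs => OpenAppSim.exists_reds_lam (hs ▸ h)⟩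
  exact ⟨(isWeakening_gammaTilde _).2 h, h⟩

/-- Every simulation on `γ̃` is contained in the open extension of applicative similarity. -/
theorem IsSimulation.le_openAppSim {R : Rel Lam} (h : IsSimulation gammaTilde R) :
    R ≤ openAppSim := by
  rw [isSimulation_gammaTilde_iff] at h
  rintro n ⟨p, q⟩ hpq
  refine (openAppSim_iff n p q).2 fun u =>
    -- The closed part of `R` is the applicative simulation, and closure under substitution places
    -- each closed instance of `(p, q)` in it.
    ⟨fun a b => (a, b) ∈ R.obj FinCard.zero, fun a b hab s hs => ?_, (h n p q hpq).1 _ u⟩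
  obtain ⟨s', hs', h'⟩ := (h _ a b hab).2.2 s hs
  -- At the identity renaming the substitution into the bodies is literally `inst`.
  exact ⟨s', hs', fun e => h' _ (𝟙 _) e⟩

end LambdaGSOS

theorem mainTheorem5 :
    LambdaGSOS.IsWeakening LambdaGSOS.gamma LambdaGSOS.gammaTilde ∧
      IsGreatest
        {R : LambdaGSOS.Rel LambdaGSOS.Lam |
          LambdaGSOS.IsWeakSimulation LambdaGSOS.gamma LambdaGSOS.gammaTilde R}
        LambdaGSOS.openAppSim :=
  ⟨LambdaGSOS.isWeakening_gammaTilde, LambdaGSOS.isWeakSimulation_openAppSim,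
    fun _ h => h.1.le_openAppSim⟩
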